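/- Let $E$ be a completely regular Hausdorff topological space such that (1) every compact subset of $E$ is metrizable, (2) the Borel $\sigma$-algebra $\mathcal B(E)$ equals the Baire $\sigma$-algebra (the one generated by the continuous functions $E\to\mathbb R$), and (3) a function $\varphi:E\to\mathbb R$ is continuous if and only if its restriction to every compact subset of $E$ is continuous. Let $\kappa:E\to(0,\infty)$ be continuous. Let $C_\kappa(E)$ be the space of continuous $\varphi:E\to\mathbb R$ with $\|\varphi\|_\kappa=\sup_{x\in E}\kappa(x)|\varphi(x)|<\infty$. The mixed topology $\tau_\kappa^{\mathscr M}$ on $C_\kappa(E)$ is the locally convex topology defined by the seminorms $$p_{\kappa,(C_n),(a_n)}(\varphi)=\sup_{n}\sup_{x\in C_n}a_n\kappa(x)|\varphi(x)|,\qquad C_n\subset E\ \text{compact},\quad 0<a_n\to0 .$$ Let $M_\kappa(E)=\kappa\cdot M_b(E)$ be the space of signed Radon measures $\mu$ on $\mathcal B(E)$ with $\int_E\kappa^{-1}\,d|\mu|<\infty$. Here $|\mu|=\mu^++\mu^-$ is the total variation of $\mu$, with $\mu^\pm$ the mutually singular parts of its Jordan decomposition, and $\mu$ is Radon if for all $B\in\mathcal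 B(E)$ and $\varepsilon>0$ there is a compact $C\subset B$ with $\int_{B\setminus C}\kappa^{-1}\,d|\mu|<\varepsilon$. For $B\in\mathcal B(E)$, $\mu(B)=\mu^+(B)-\mu^-(B)\in[-\infty,\infty]$. Both terms are finite if $\kappa$ is bounded on $B$; otherwise the convention $\infty-\infty=-\infty$ is used. $M_\kappa(E)$ carries the narrow topology, the weakest topology for which $\mu\mapsto\int_E\varphi\,d\mu$ is continuous for every $\varphi\in C_\kappa(E)$. A family $\mathcal F$ of nonnegative measures is tight if for every $\varepsilon>0$ there is a compact $K\subset E$ with $\sup_{\rho\in\mathcal F}\rho(E\setminus K)<\varepsilon$. A semigroup on $C_\kappa(E)$ is a family $P=(P_t)_{t\ge0}$ of maps $C_\kappa(E)\to C_\kappa(E)$ with $P_0\varphi=\varphi$ and $P_sP_t\varphi=P_{s+t}\varphi$ for all $s,t\ge0$ and $\varphi\in C_\kappa(E)$. It is a $C_0$-semigroup on $(C_\kappa(E),\tau_\kappa^{\mathscr M})$ if in addition * for every $T\ge0$, every $\varepsilon>0$ and every seminorm $p=p_{\kappa,(K_n),(a_n)}$ there are a seminorm $q=p_{\kappa,(C_n),(b_n)}$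 and $\delta>0$ such that $p(P_t\varphi_1-P_t\varphi_2)<\varepsilon$ whenever $0\le t\le T$, $\varphi_1,\varphi_2\in C_\kappa(E)$ and $q(\varphi_1-\varphi_2)<\delta$; and * $P_t\varphi\to\varphi$ in $\tau_\kappa^{\mathscr M}$ as $t\to0$, for every $\varphi\in C_\kappa(E)$. **Theorem.** Let $P=(P_t)_{t\ge0}$ be a semigroup of linear operators on $C_\kappa(E)$. The following are equivalent. (a) $P$ is a $C_0$-semigroup on $(C_\kappa(E),\tau_\kappa^{\mathscr M})$. (b) There is a family $\{\mu_t(x,\cdot):x\in E,\ t\ge0\}\subset M_\kappa(E)$ such that 1. for every $t\ge0$ and $B\in\mathcal B(E)$, the map $x\mapsto\mu_t(x,B)$ is Borel measurable; 2. $P_t\varphi(x)=\int_E\varphi(y)\,\mu_t(x,dy)$ for all $t\ge0$, $\varphi\in C_\kappa(E)$, $x\in E$; 3. for every $T\ge0$, $\displaystyle\sup_{t\le T}\sup_{x\in E}\Big(\kappa(x)\int_E\frac{|\mu_t|(x,dy)}{\kappa(y)}\Big)<\infty$; 4. for every $T\ge0$ and every compact $C\subset E$, the family of measures $\Big\{\dfrac{\kappa(x)\,|\mu_t|(x,dy)}{\kappa(y)}:x\in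 C,\ t\in[0,T]\Big\}$ is tight; 5. for every $x\in E$ and every sequence $x_n\to x$ in $E$, $\mu_t(x_n,\cdot)\to\delta_x$ in the narrow topology of $M_\kappa(E)$ as $t\to0$, $t\ge0$, and $n\to\infty$ jointly. -/

import Mathlib

open MeasureTheory Filter Topology
open scoped NNReal ENNReal

/-- The standing assumptions on the state space `E`, which is in addition a completely regular
Hausdorff space: compact sets are metrizable, the Borel σ-algebra is the Baire σ-algebra (the one
generated by the continuous real functions), and continuity of real functions can be tested on
compact sets. -/
structure IsStateSpace (E : Type*) [TopologicalSpace E] : Prop where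
  metrizable_of_isCompact : ∀ K : Set E, IsCompact K → TopologicalSpace.MetrizableSpace K
  borel_eq_baire : borel E = ⨆ f : C(E, ℝ), (borel ℝ).comap f
  continuous_iff : ∀ φ : E → ℝ, Continuous φ ↔ ∀ K : Set E, IsCompact K → ContinuousOn φ K

section WeightedContinuousFunctions

variable {E : Type*} [TopologicalSpace E]

/-- The continuous functions `φ` with `sup |κ φ| < ∞`, as a linear subspace of `C(E, ℝ)`. -/
def weightedSubmodule (κ : C(E, ℝ)) : Submodule ℝ C(E, ℝ) where
  carrier := {φ | ∃ M : ℝ, ∀ x, |κ x * φ x| ≤ M}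
  zero_mem' := ⟨0, by simp⟩
  add_mem' := by
    rintro φ ψ ⟨M, hM⟩ ⟨N, hN⟩
    refine ⟨M + N, fun x => ?_⟩
    have h : κ x * (φ + ψ) x = κ x * φ x + κ x * ψ x := by
      rw [ContinuousMap.add_apply]; ring
    rw [h]
    exact (abs_add_le _ _).trans (add_le_add (hM x) (hN x))
  smul_mem' := by
    rintro c φ ⟨M, hM⟩
    refine ⟨|c| * M, fun x => ?_⟩
    have h : κ x * (c • φ) x = c * (κ x * φ x) := by
      rw [ContinuousMap.smul_apply, smul_eq_mul]; ring
    rw [h, abs_mul]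
    exact mul_le_mul_of_nonneg_left (hM x) (abs_nonneg c)

/-- The space `C_κ(E)`. It is a separate type, so that the compact-open topology of `C(E, ℝ)` is
not inherited; its topology is the mixed topology below. -/
def WeightedCont (κ : C(E, ℝ)) : Type _ := weightedSubmodule κ

namespace WeightedCont

variable {κ : C(E, ℝ)}

noncomputable instance : AddCommGroup (WeightedCont κ) :=
  inferInstanceAs (AddCommGroup (weightedSubmodule κ))

noncomputable instance : Module ℝ (WeightedCont κ) :=
  inferInstanceAs (Module ℝ (weightedSubmodule κ))

instance : CoeFun (WeightedCont κ) (fun _ => E → ℝ) := ⟨fun φ => φ.1⟩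

theorem continuous (φ : WeightedCont κ) : Continuous φ := φ.1.continuous

theorem exists_bound (φ : WeightedCont κ) : ∃ M : ℝ, ∀ x, |κ x * φ x| ≤ M := φ.2

theorem add_apply (φ ψ : WeightedCont κ) (x : E) : (φ + ψ) x = φ x + ψ x := rfl

theorem sub_apply (φ ψ : WeightedCont κ) (x : E) : (φ - ψ) x = φ x - ψ x := rfl

theorem smul_apply (c : ℝ) (φ : WeightedCont κ) (x : E) : (c • φ) x = c * φ x := rfl

end WeightedCont

/-- The data of a defining seminorm of the mixed topology: a sequence of compact sets and a
sequence of positive numbers tending to zero. -/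
structure MixedIndex (E : Type*) [TopologicalSpace E] where
  C : ℕ → Set E
  isCompact_C : ∀ n, IsCompact (C n)
  a : ℕ → ℝ
  a_pos : ∀ n, 0 < a n
  tendsto_a : Tendsto a atTop (𝓝 0)

instance : Nonempty (MixedIndex E) :=
  ⟨⟨fun _ => ∅, fun _ => isCompact_empty, fun n => 1 / ((n : ℝ) + 1),
    fun n => by positivity, tendsto_one_div_add_atTop_nhds_zero_nat⟩⟩

/-- The value `sup_n sup_{x ∈ C_n} a_n κ(x) |φ(x)|`. -/
noncomputable def mixedValue (κ : C(E, ℝ)) (i : MixedIndex E) (φ : WeightedCont κ) : ℝ :=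
  ⨆ n, ⨆ x : i.C n, i.a n * |κ x * φ x|

section MixedValue

variable {κ : C(E, ℝ)}

/-- The suprema in `mixedValue` are suprema of bounded families. -/
theorem exists_mixedValue_bound (i : MixedIndex E) (φ : WeightedCont κ) :
    ∃ M : ℝ, 0 ≤ M ∧ ∀ n x, i.a n * |κ x * φ x| ≤ M := by
  obtain ⟨M, hM⟩ := φ.exists_bound
  obtain ⟨A, hA⟩ := i.tendsto_a.bddAbove_range
  have hA' : ∀ n, i.a n ≤ A := fun n => hA ⟨n, rfl⟩
  have hA0 : 0 ≤ A := (i.a_pos 0).le.trans (hA' 0)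
  refine ⟨A * |M|, by positivity, fun n x => ?_⟩
  exact mul_le_mul (hA' n) ((hM x).trans (le_abs_self M)) (abs_nonneg _) hA0

theorem le_mixedValue (i : MixedIndex E) (φ : WeightedCont κ) (n : ℕ) (x : E) (hx : x ∈ i.C n) :
    i.a n * |κ x * φ x| ≤ mixedValue κ i φ := by
  obtain ⟨M, hM0, hM⟩ := exists_mixedValue_bound i φ
  have h1 : i.a n * |κ x * φ x| ≤ ⨆ x : i.C n, i.a n * |κ x * φ x| :=
    le_ciSup (f := fun x : i.C n => i.a n * |κ x * φ x|)
      ⟨M, by rintro _ ⟨y, rfl⟩; exact hM n y⟩ ⟨x, hx⟩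
  exact h1.trans (le_ciSup (f := fun n => ⨆ x : i.C n, i.a n * |κ x * φ x|)
    ⟨M, by rintro _ ⟨m, rfl⟩; exact Real.iSup_le (fun y => hM m y) hM0⟩ n)

theorem mixedValue_le (i : MixedIndex E) (φ : WeightedCont κ) {M : ℝ} (hM0 : 0 ≤ M)
    (hM : ∀ n, ∀ x ∈ i.C n, i.a n * |κ x * φ x| ≤ M) : mixedValue κ i φ ≤ M :=
  Real.iSup_le (fun n => Real.iSup_le (fun x => hM n x x.2) hM0) hM0

theorem mixedValue_nonneg (i : MixedIndex E) (φ : WeightedCont κ) : 0 ≤ mixedValue κ i φ :=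
  Real.iSup_nonneg fun n => Real.iSup_nonneg fun _ =>
    mul_nonneg (i.a_pos n).le (abs_nonneg _)

end MixedValue

/-- The seminorms `p_{κ,(C_n),(a_n)}(φ) = sup_n sup_{x ∈ C_n} a_n κ(x) |φ(x)|` on `C_κ(E)`. -/
noncomputable def mixedSeminorm (κ : C(E, ℝ)) :
    SeminormFamily ℝ (WeightedCont κ) (MixedIndex E) := fun i =>
  Seminorm.ofSMulLE (mixedValue κ i)
    (le_antisymm
      (mixedValue_le i _ le_rfl fun n x _ => by
        have h : (0 : WeightedCont κ) x = 0 := rfl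
        simp [h])
      (mixedValue_nonneg i _))
    (fun φ ψ => mixedValue_le i _ (add_nonneg (mixedValue_nonneg i φ) (mixedValue_nonneg i ψ))
      fun n x hx => by
        refine le_trans ?_ (add_le_add (le_mixedValue i φ n x hx) (le_mixedValue i ψ n x hx))
        rw [WeightedCont.add_apply, mul_add (κ x), ← mul_add (i.a n)]
        exact mul_le_mul_of_nonneg_left (abs_add_le _ _) (i.a_pos n).le)
    (fun c φ => mixedValue_le i _ (mul_nonneg (norm_nonneg c) (mixedValue_nonneg i φ))
      fun n x hx => by
        refine le_trans (le_of_eq ?_)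
          (mul_le_mul_of_nonneg_left (le_mixedValue i φ n x hx) (norm_nonneg c))
        rw [WeightedCont.smul_apply, Real.norm_eq_abs, mul_left_comm (κ x) c, abs_mul c]
        ring)

theorem mixedSeminorm_apply (κ : C(E, ℝ)) (i : MixedIndex E) (φ : WeightedCont κ) :
    mixedSeminorm κ i φ = ⨆ n, ⨆ x : i.C n, i.a n * |κ x * φ x| := rfl

/-- The mixed topology on `C_κ(E)`: the locally convex topology defined by the seminorms
`p_{κ,(C_n),(a_n)}`. -/
noncomputable instance mixedTopology (κ : C(E, ℝ)) : TopologicalSpace (WeightedCont κ) :=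
  (mixedSeminorm κ).moduleFilterBasis.topology

theorem withSeminorms_mixedSeminorm (κ : C(E, ℝ)) : WithSeminorms (mixedSeminorm κ) := ⟨rfl⟩

/-- A semigroup of (possibly nonlinear) operators on `C_κ(E)`. -/
structure IsOperatorSemigroup (κ : C(E, ℝ)) (P : ℝ≥0 → WeightedCont κ → WeightedCont κ) :
    Prop where
  map_zero : ∀ φ, P 0 φ = φ
  map_add : ∀ s t φ, P s (P t φ) = P (s + t) φ

/-- A `C₀`-semigroup on `C_κ(E)` with the mixed topology: a semigroup that is locally uniformly
equicontinuous and strongly right continuous at zero for the mixed topology. -/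
structure IsC0Semigroup (κ : C(E, ℝ)) (P : ℝ≥0 → WeightedCont κ → WeightedCont κ) : Prop
    extends IsOperatorSemigroup κ P where
  locally_equicontinuous : ∀ T : ℝ≥0, ∀ ε : ℝ, 0 < ε → ∀ i : MixedIndex E,
    ∃ j : MixedIndex E, ∃ δ : ℝ, 0 < δ ∧ ∀ t ≤ T, ∀ φ₁ φ₂ : WeightedCont κ,
      mixedSeminorm κ j (φ₁ - φ₂) < δ → mixedSeminorm κ i (P t φ₁ - P t φ₂) < ε
  right_continuous : ∀ φ : WeightedCont κ, Tendsto (fun t => P t φ) (𝓝 0) (𝓝 φ)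

end WeightedContinuousFunctions

section WeightedMeasures

variable {E : Type*} [TopologicalSpace E] [MeasurableSpace E]

/-- The measure `κ⁻¹ ρ` for a nonnegative measure `ρ`. -/
noncomputable def divWeight (κ : C(E, ℝ)) (ρ : Measure E) : Measure E :=
  ρ.withDensity fun y => ENNReal.ofReal (κ y)⁻¹

/-- The space `M_κ(E) = κ · M_b(E)` of signed Radon measures `μ` with `∫ κ⁻¹ d|μ| < ∞`. An element
is given by its Jordan decomposition: `pos` and `neg` are the positive and negative parts, which
may be infinite measures when `κ` is unbounded. The Radon property is that of the finite measure
`κ⁻¹ |μ|`: every Borel set is approximated from inside by compact sets. -/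
@[ext]
structure WeightedMeasure (κ : C(E, ℝ)) where
  pos : Measure E
  neg : Measure E
  mutuallySingular : pos ⟂ₘ neg
  lintegral_lt_top : ∫⁻ y, ENNReal.ofReal (κ y)⁻¹ ∂(pos + neg) < ∞
  radon : ∀ B : Set E, MeasurableSet B → ∀ ε : ℝ≥0∞, 0 < ε →
    ∃ C ⊆ B, IsCompact C ∧ divWeight κ (pos + neg) (B \ C) < ε

namespace WeightedMeasure

variable {κ : C(E, ℝ)}

/-- The total variation measure `|μ|`. -/
noncomputable def variation (μ : WeightedMeasure κ) : Measure E := μ.pos + μ.neg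

/-- The value `μ(B) = μ⁺(B) - μ⁻(B)`. If `κ` is bounded on `B`, both terms are finite. In general
this is an extended real number, with the convention `∞ - ∞ = -∞`. -/
noncomputable def value (μ : WeightedMeasure κ) (B : Set E) : EReal :=
  (μ.pos B : EReal) - (μ.neg B : EReal)

/-- The integral `∫ φ dμ`, for `φ ∈ C_κ(E)`. -/
noncomputable def integral (μ : WeightedMeasure κ) (φ : WeightedCont κ) : ℝ :=
  (∫ y, φ y ∂μ.pos) - ∫ y, φ y ∂μ.neg

/-- The narrow topology: the weakest topology for which `μ ↦ ∫ φ dμ` is continuous for every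
`φ ∈ C_κ(E)`. -/
noncomputable instance narrowTopology : TopologicalSpace (WeightedMeasure κ) :=
  ⨅ φ : WeightedCont κ, TopologicalSpace.induced (fun μ => μ.integral φ) inferInstance

/-- The Dirac measure at `x`, as an element of `M_κ(E)`. -/
noncomputable def dirac [T2Space E] [BorelSpace E] (κ : C(E, ℝ)) (x : E) : WeightedMeasure κ where
  pos := Measure.dirac x
  neg := 0
  mutuallySingular := Measure.MutuallySingular.zero_right
  lintegral_lt_top := by simp
  radon := by
    intro B hB ε hε
    by_cases hx : x ∈ B
    · refine ⟨{x}, by simpa using hx, isCompact_singleton, ?_⟩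
      have h0 : divWeight κ (Measure.dirac x + 0) (B \ {x}) = 0 := by
        apply withDensity_absolutelyContinuous
        rw [add_zero, Measure.dirac_apply' _ (hB.diff (measurableSet_singleton x))]
        simp
      rwa [h0]
    · refine ⟨∅, Set.empty_subset _, isCompact_empty, ?_⟩
      have h0 : divWeight κ (Measure.dirac x + 0) (B \ ∅) = 0 := by
        apply withDensity_absolutelyContinuous
        rw [add_zero, Set.sdiff_empty, Measure.dirac_apply' _ hB]
        simp [hx]
      rwa [h0]

end WeightedMeasure

end WeightedMeasures

/-!
Write the signed kernels as `μ_t(x, ·) = κ · (p - q)` with `p`, `q` finite and mutually singular.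

*From the semigroup to the kernels.* By equicontinuity and linearity, `φ ↦ P_t φ(x)` is bounded by
a single seminorm `p_{κ,(C_n),(a_n)}`. The functions `a_n κ φ` on the disjoint union of the compact
sets `C_n` vanish at infinity, so the functional factors through continuous functions on a one-point
compactification. Hahn–Banach and Riesz–Markov–Kakutani there give finite regular measures, which
are pushed forward to `E` (`WeightedCont.exists_measures_of_le_mixedSeminorm`). For an open set `U`,
the numbers `p(U)` and `q(U)` are suprema of `±∫ f d(p - q)` over continuous `0 ≤ f ≤ 1`
supported in `U` (`exists_continuousMap_measureReal_le`). This one fact yields three of the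
properties: `x ↦ p(U)` is a supremum of continuous functions of `x`, hence lower semicontinuous, so
that both Jordan parts, and with them the extended real `μ_t(x, B)`, are measurable in `x`; with
`U = E` and the uniform boundedness of `P_t` in the weighted norm it gives the bound on the total
variation; with `U` the complement of finitely many of the `C_n` it gives tightness. Joint
convergence to `δ_x` is uniform convergence of `P_t φ` on the compact set formed by a convergent
sequence and its limit.

*From the kernels to the semigroup.* Choose compact sets `K_{n,j}` outside which the kernels started
in `C_n` have weighted mass at most `4^{-j}`. If `κ |φ| ≤ 2^j δ` on every `K_{n,j}`, then
`κ |P_t φ| ≤ (N + 4) δ` on `C_n` (`lintegral_le_of_compl_le`), so the seminorm with the compact sets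
`K_{n,j}` and weights `a_n 2^{-j}` controls the given one. Strong continuity follows because on
compact metrizable sets joint sequential convergence is uniform convergence, and on weighted-bounded
families this is convergence in the mixed topology.
-/

/-! ### Bounded functionals as differences of positive functionals -/

namespace ContinuousMap

variable {X : Type*} [TopologicalSpace X] [CompactSpace X]

theorem norm_sup_zero_le_iff (f : C(X, ℝ)) {M : ℝ} (hM : 0 ≤ M) :
    ‖f ⊔ 0‖ ≤ M ↔ ∀ x, f x ≤ M := by
  rw [ContinuousMap.norm_le _ hM]
  refine forall_congr' fun x => ?_
  have h0 : (f ⊔ 0) x = max (f x) 0 := rfl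
  rw [h0, Real.norm_of_nonneg (le_max_right _ _)]
  exact ⟨fun h => (le_max_left _ _).trans h, fun h => max_le h hM⟩

theorem le_norm_sup_zero (f : C(X, ℝ)) (x : X) : f x ≤ ‖f ⊔ 0‖ :=
  (norm_sup_zero_le_iff f (norm_nonneg _)).1 le_rfl x

theorem norm_sup_zero_add_le (f g : C(X, ℝ)) : ‖(f + g) ⊔ 0‖ ≤ ‖f ⊔ 0‖ + ‖g ⊔ 0‖ :=
  (norm_sup_zero_le_iff _ (by positivity)).2 fun x =>
    add_le_add (le_norm_sup_zero f x) (le_norm_sup_zero g x)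

theorem norm_sup_zero_smul {c : ℝ} (hc : 0 < c) (f : C(X, ℝ)) :
    ‖(c • f) ⊔ 0‖ = c * ‖f ⊔ 0‖ := by
  have h : (c • f) ⊔ 0 = c • (f ⊔ 0) := by
    ext x
    change max (c * f x) 0 = c * max (f x) 0
    rw [mul_max_of_nonneg _ _ hc.le, mul_zero]
  rw [h, norm_smul, Real.norm_of_nonneg hc.le]

/-- The Riesz–Markov–Kakutani theorem for a positive functional on `C(X, ℝ)`, with `X` compact. -/
theorem exists_regular_measure [T2Space X] [MeasurableSpace X] [BorelSpace X]
    (Φ : C(X, ℝ) →ₗ[ℝ] ℝ) (hΦ : ∀ f, 0 ≤ f → 0 ≤ Φ f) :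
    ∃ p : Measure X, IsFiniteMeasure p ∧ p.Regular ∧ ∀ f : C(X, ℝ), Φ f = ∫ x, f x ∂p := by
  let Ψ : CompactlySupportedContinuousMap X ℝ →ₚ[ℝ] ℝ := PositiveLinearMap.mk₀
    { toFun := fun f => Φ f
      map_add' := fun f g => Φ.map_add f g
      map_smul' := fun c f => Φ.map_smul c f }
    (fun f hf => hΦ _ hf)
  refine ⟨RealRMK.rieszMeasure Ψ, inferInstance, inferInstance, fun f => ?_⟩
  exact (RealRMK.integral_rieszMeasure Ψ (CompactlySupportedContinuousMap.continuousMapEquiv f)).symm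

/-- A functional `L` on `V` that is bounded through a linear map `J : V → C(X, ℝ)` is the difference
of two positive functionals of `J v`. Both the extension from the range of `J` and the splitting
into positive parts come from one sublinear functional on `V × C(X, ℝ) × C(X, ℝ)`. -/
theorem exists_pos_sub_of_le_norm {V : Type*} [AddCommGroup V] [Module ℝ V]
    (J : V →ₗ[ℝ] C(X, ℝ)) (L : V →ₗ[ℝ] ℝ) {c : ℝ} (hc : 0 ≤ c) (hL : ∀ v, L v ≤ c * ‖J v‖) :
    ∃ A B : C(X, ℝ) →ₗ[ℝ] ℝ, (∀ f, 0 ≤ f → 0 ≤ A f) ∧ (∀ f, 0 ≤ f → 0 ≤ B f) ∧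
      ∀ v, L v = A (J v) - B (J v) := by
  let N : V × C(X, ℝ) × C(X, ℝ) → ℝ := fun w =>
    c * max ‖(w.2.1 + J w.1) ⊔ 0‖ ‖(w.2.2 - J w.1) ⊔ 0‖
  have N_hom : ∀ a : ℝ, 0 < a → ∀ w, N (a • w) = a * N w := by
    intro a ha w
    have h1 : (a • w).2.1 + J (a • w).1 = a • (w.2.1 + J w.1) := by
      simp [smul_add]
    have h2 : (a • w).2.2 - J (a • w).1 = a • (w.2.2 - J w.1) := by
      simp [smul_sub]
    simp only [N]
    rw [h1, h2, norm_sup_zero_smul ha, norm_sup_zero_smul ha, ← mul_max_of_nonneg _ _ ha.le]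
    ring
  have N_add : ∀ w z, N (w + z) ≤ N w + N z := by
    intro w z
    have h1 : (w + z).2.1 + J (w + z).1 = (w.2.1 + J w.1) + (z.2.1 + J z.1) := by
      simp only [Prod.fst_add, Prod.snd_add, map_add]; abel
    have h2 : (w + z).2.2 - J (w + z).1 = (w.2.2 - J w.1) + (z.2.2 - J z.1) := by
      simp only [Prod.fst_add, Prod.snd_add, map_add]; abel
    simp only [N]
    rw [h1, h2, ← mul_add]
    refine mul_le_mul_of_nonneg_left (max_le ?_ ?_) hc
    · exact (norm_sup_zero_add_le _ _).trans (add_le_add (le_max_left _ _) (le_max_left _ _))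
    · exact (norm_sup_zero_add_le _ _).trans (add_le_add (le_max_right _ _) (le_max_right _ _))
  have hNL : ∀ v, L v ≤ N (v, 0, 0) := by
    intro v
    refine (hL v).trans (mul_le_mul_of_nonneg_left ?_ hc)
    rw [ContinuousMap.norm_le _ ((norm_nonneg _).trans (le_max_left _ _))]
    intro x
    rw [Real.norm_eq_abs]
    refine abs_le'.2 ⟨le_trans ?_ (le_max_left _ _), le_trans ?_ (le_max_right _ _)⟩
    · simpa using le_norm_sup_zero ((0 : C(X, ℝ)) + J v) x
    · simpa using le_norm_sup_zero ((0 : C(X, ℝ)) - J v) x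
  obtain ⟨G, hG, hGN⟩ := exists_extension_of_le_sublinear
    ⟨LinearMap.ker (LinearMap.snd ℝ V (C(X, ℝ) × C(X, ℝ))),
      (L ∘ₗ LinearMap.fst ℝ V (C(X, ℝ) × C(X, ℝ))) ∘ₗ Submodule.subtype _⟩ N N_hom N_add (by
      rintro ⟨⟨v, w⟩, hw⟩
      obtain rfl : w = 0 := hw
      exact hNL v)
  have hGL : ∀ v, G (v, 0, 0) = L v := fun v => hG ⟨(v, 0, 0), rfl⟩
  have key : ∀ v, G (v, -J v, J v) ≤ 0 := fun v => by
    refine (hGN _).trans (le_of_eq ?_)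
    simp [N]
  have key0 : ∀ v, G (v, -J v, J v) = 0 := fun v => by
    refine le_antisymm (key v) ?_
    have h := key (-v)
    have h2 : ((-v, -J (-v), J (-v)) : V × C(X, ℝ) × C(X, ℝ)) = -(v, -J v, J v) := by simp
    rw [h2, map_neg] at h
    linarith
  refine ⟨G ∘ₗ LinearMap.inr ℝ V _ ∘ₗ LinearMap.inl ℝ _ _,
    G ∘ₗ LinearMap.inr ℝ V _ ∘ₗ LinearMap.inr ℝ _ _, fun f hf => ?_, fun f hf => ?_, fun v => ?_⟩
  · have h := hGN (0, -f, 0)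
    have h2 : ((0, -f, 0) : V × C(X, ℝ) × C(X, ℝ)) = -(0, f, 0) := by simp
    have h3 : N (0, -f, 0) = 0 := by simp [N, hf]
    rw [h3, h2, map_neg] at h
    simpa using h
  · have h := hGN (0, 0, -f)
    have h2 : ((0, 0, -f) : V × C(X, ℝ) × C(X, ℝ)) = -(0, 0, f) := by simp
    have h3 : N (0, 0, -f) = 0 := by simp [N, hf]
    rw [h3, h2, map_neg] at h
    simpa using h
  · have h1 : ((v, -J v, J v) : V × C(X, ℝ) × C(X, ℝ))
        = (v, 0, 0) - (0, J v, 0) + (0, 0, J v) := by simp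
    have h2 := key0 v
    rw [h1, map_add, map_sub, hGL] at h2
    change L v = G (0, J v, 0) - G (0, 0, J v)
    linarith

end ContinuousMap

/-! ### Separation in completely regular spaces -/

theorem IsCompact.exists_continuousMap_one_of_isClosed {E : Type*} [TopologicalSpace E]
    [CompletelyRegularSpace E] {A F : Set E} (hA : IsCompact A) (hF : IsClosed F)
    (hAF : Disjoint A F) :
    ∃ f : C(E, ℝ), (∀ x, 0 ≤ f x) ∧ (∀ x, f x ≤ 1) ∧ (∀ x ∈ A, f x = 1) ∧ ∀ x ∈ F, f x = 0 := by
  suffices h : ∃ f : C(E, ℝ), (∀ x, 0 ≤ f x) ∧ (∀ x, f x ≤ 1) ∧ (∀ x ∈ A, f x = 0) ∧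
      ∀ x ∈ F, f x = 1 by
    obtain ⟨f, h0, h1, hfA, hfF⟩ := h
    refine ⟨1 - f, fun x => ?_, fun x => ?_, fun x hx => ?_, fun x hx => ?_⟩
    · simpa using h1 x
    · simpa using h0 x
    · simp [hfA x hx]
    · simp [hfF x hx]
  refine hA.induction_on (p := fun s => ∃ f : C(E, ℝ), (∀ x, 0 ≤ f x) ∧ (∀ x, f x ≤ 1) ∧
    (∀ x ∈ s, f x = 0) ∧ ∀ x ∈ F, f x = 1) ⟨1, by simp, by simp, by simp, by simp⟩ ?_ ?_ ?_
  · rintro s t hst ⟨f, h0, h1, hft, hfF⟩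
    exact ⟨f, h0, h1, fun x hx => hft x (hst hx), hfF⟩
  · rintro s t ⟨f, h0, h1, hfs, hfF⟩ ⟨g, k0, k1, hgt, hgF⟩
    refine ⟨f * g, fun x => mul_nonneg (h0 x) (k0 x), fun x => mul_le_one₀ (h1 x) (k0 x) (k1 x),
      ?_, fun x hx => by simp [hfF x hx, hgF x hx]⟩
    rintro x (hx | hx)
    · simp [hfs x hx]
    · simp [hgt x hx]
  · intro x hx
    obtain ⟨f, hf, hfx, hfF⟩ := CompletelyRegularSpace.completely_regular x F hF
      (Set.disjoint_left.1 hAF hx)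
    have hf' : Continuous fun y => (f y : ℝ) := continuous_subtype_val.comp hf
    refine ⟨{y | (f y : ℝ) < 1 / 2}, mem_nhdsWithin_of_mem_nhds
      ((isOpen_lt hf' continuous_const).mem_nhds (by simp [hfx])),
      ⟨fun y => max 0 (2 * (f y : ℝ) - 1), by fun_prop⟩, fun y => le_max_left _ _, fun y => ?_,
      fun y hy => ?_, fun y hy => ?_⟩
    · have := (f y).2.2
      exact max_le zero_le_one (by linarith)
    · have : (f y : ℝ) < 1 / 2 := hy
      exact max_eq_left (by linarith)
    · have h1 : (f y : ℝ) = 1 := by rw [hfF hy]; rfl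
      change max 0 (2 * (f y : ℝ) - 1) = 1
      rw [h1]; norm_num

/-! ### Inner approximation by compact sets -/

/-- Every Borel set is approximated from inside by compact sets, up to small measure. This is the
property required of `κ⁻¹ |μ|` in `WeightedMeasure`. -/
def CompactApprox {E : Type*} [TopologicalSpace E] [MeasurableSpace E] (ρ : Measure E) : Prop :=
  ∀ B : Set E, MeasurableSet B → ∀ ε : ℝ≥0∞, 0 < ε → ∃ C ⊆ B, IsCompact C ∧ ρ (B \ C) < ε

namespace CompactApprox

variable {E : Type*} [TopologicalSpace E] [MeasurableSpace E] {ρ σ : Measure E}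

theorem mono (h : CompactApprox σ) (hle : ρ ≤ σ) : CompactApprox ρ := fun B hB ε hε => by
  obtain ⟨C, hCB, hC, hlt⟩ := h B hB ε hε
  exact ⟨C, hCB, hC, (hle _).trans_lt hlt⟩

theorem add (h₁ : CompactApprox ρ) (h₂ : CompactApprox σ) : CompactApprox (ρ + σ) :=
  fun B hB ε hε => by
    obtain ⟨C, hCB, hC, hlt⟩ := h₁ B hB (ε / 2) (ENNReal.half_pos hε.ne')
    obtain ⟨D, hDB, hD, hlt'⟩ := h₂ B hB (ε / 2) (ENNReal.half_pos hε.ne')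
    refine ⟨C ∪ D, Set.union_subset hCB hDB, hC.union hD, ?_⟩
    rw [Measure.add_apply, ← ENNReal.add_halves ε]
    exact ENNReal.add_lt_add
      ((measure_mono (Set.sdiff_subset_sdiff_right Set.subset_union_left)).trans_lt hlt)
      ((measure_mono (Set.sdiff_subset_sdiff_right Set.subset_union_right)).trans_lt hlt')

theorem smul (h : CompactApprox ρ) (c : ℝ≥0) : CompactApprox ((c : ℝ≥0∞) • ρ) :=
  fun B hB ε hε => by
    rcases eq_or_ne c 0 with rfl | hc
    · exact ⟨∅, Set.empty_subset _, isCompact_empty, by simpa using hε⟩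
    obtain ⟨C, hCB, hC, hlt⟩ := h B hB (ε / c) (ENNReal.div_pos hε.ne' ENNReal.coe_ne_top)
    refine ⟨C, hCB, hC, ?_⟩
    rw [Measure.smul_apply, smul_eq_mul]
    exact ENNReal.mul_lt_of_lt_div' hlt

/-- A finite regular measure on a compactification of `Y`, restricted to `Y` and pushed forward along
a continuous map, is approximated by compact sets. -/
theorem map_comap {X Y : Type*} [TopologicalSpace X] [T2Space X] [MeasurableSpace X] [BorelSpace X]
    [TopologicalSpace Y] [MeasurableSpace Y] [BorelSpace Y] [T2Space E] [BorelSpace E]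
    {j : Y → X} (hj : IsOpenEmbedding j) {g : Y → E} (hg : Continuous g)
    (ρ : Measure X) [IsFiniteMeasure ρ] [ρ.Regular] : CompactApprox ((ρ.comap j).map g) := by
  intro B hB ε hε
  have hjm := hj.measurableEmbedding
  obtain ⟨K, hKB, hK, hlt⟩ := (hjm.measurableSet_image.2 (hg.measurable hB)).exists_isCompact_sdiff_lt
    (measure_ne_top ρ _) hε.ne'
  have hK' : IsCompact (j ⁻¹' K) :=
    hj.isInducing.isCompact_preimage' hK (hKB.trans (Set.image_subset_range _ _))
  refine ⟨g '' (j ⁻¹' K), ?_, hK'.image hg, ?_⟩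
  · rintro _ ⟨y, hy, rfl⟩
    obtain ⟨z, hz, hzy⟩ := hKB hy
    exact hj.injective hzy ▸ hz
  · refine lt_of_le_of_lt ?_ hlt
    rw [Measure.map_apply hg.measurable (hB.diff (hK'.image hg).measurableSet),
      hjm.comap_apply]
    refine measure_mono ?_
    rintro _ ⟨y, hy, rfl⟩
    exact ⟨⟨y, hy.1, rfl⟩, fun hyK => hy.2 ⟨y, hyK, rfl⟩⟩

end CompactApprox

/-! ### Jordan decompositions -/

theorem integral_sub_integral_eq_jordan {E : Type*} [MeasurableSpace E] (p q : Measure E)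
    [IsFiniteMeasure p] [IsFiniteMeasure q] (f : E → ℝ) (hp : Integrable f p)
    (hq : Integrable f q) :
    ∫ x, f x ∂p - ∫ x, f x ∂q = ∫ x, f x ∂(p - q) - ∫ x, f x ∂(q - p) := by
  have h : p + (q - p) = q + (p - q) := by
    rw [← Measure.toSignedMeasure_eq_toSignedMeasure_iff, Measure.toSignedMeasure_add,
      Measure.toSignedMeasure_add]
    have := Measure.sub_toSignedMeasure_eq_toSignedMeasure_sub (μ := p) (ν := q)
    rw [sub_eq_sub_iff_add_eq_add] at this
    rw [this, add_comm]
  have h' := congrArg (fun m => ∫ x, f x ∂m) h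
  rw [integral_add_measure hp (hq.mono_measure Measure.sub_le),
    integral_add_measure hq (hp.mono_measure Measure.sub_le)] at h'
  linarith


/-! ### Integral representation of functionals bounded by a mixed seminorm -/

section Representation

variable {E : Type*} [TopologicalSpace E] [T2Space E] [MeasurableSpace E] [BorelSpace E]
  {Y : Type*} [TopologicalSpace Y] [T2Space Y] [WeaklyLocallyCompactSpace Y]

/-- Push a measure on the one-point compactification of `Y` forward to `E`, with a density `w`;
the point at infinity is discarded. -/
theorem exists_compactApprox_of_onePoint [MeasurableSpace (OnePoint Y)] [BorelSpace (OnePoint Y)]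
    {g : Y → E} (hg : Continuous g) {w : Y → ℝ} (hw : Continuous w) (hw0 : ∀ y, 0 ≤ w y) {A : ℝ}
    (hwA : ∀ y, w y ≤ A) (ρ : Measure (OnePoint Y)) [IsFiniteMeasure ρ] [ρ.Regular] :
    ∃ p : Measure E, IsFiniteMeasure p ∧ CompactApprox p ∧
      ∀ (F : OnePoint Y → ℝ) (h : E → ℝ), Continuous h → F OnePoint.infty = 0 →
        (∀ y : Y, F y = w y * h (g y)) → ∫ z, F z ∂ρ = ∫ x, h x ∂p := by
  let _ : MeasurableSpace Y := borel Y
  have : BorelSpace Y := ⟨rfl⟩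
  have hj : IsOpenEmbedding ((↑) : Y → OnePoint Y) := OnePoint.isOpenEmbedding_coe
  have hjm := hj.measurableEmbedding
  let σ := ρ.comap ((↑) : Y → OnePoint Y)
  have hσ : IsFiniteMeasure σ := ⟨by
    rw [hjm.comap_apply]; exact measure_lt_top _ _⟩
  let W : Y → ℝ≥0∞ := fun y => ENNReal.ofReal (w y)
  have hW : Measurable W := hw.measurable.ennreal_ofReal
  have hle : (σ.withDensity W).map g ≤ ((A.toNNReal : ℝ≥0) : ℝ≥0∞) • σ.map g := by
    rw [← Measure.map_smul]
    refine Measure.map_mono ?_ hg.measurable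
    rw [← withDensity_const]
    exact withDensity_mono (ae_of_all _ fun y => ENNReal.ofReal_le_ofReal (hwA y))
  have hca : CompactApprox ((σ.withDensity W).map g) :=
    ((CompactApprox.map_comap hj hg ρ).smul _).mono hle
  have hfin : IsFiniteMeasure (((A.toNNReal : ℝ≥0) : ℝ≥0∞) • σ.map g) :=
    Measure.smul_finite _ ENNReal.coe_ne_top
  refine ⟨(σ.withDensity W).map g, isFiniteMeasure_of_le _ hle, hca, fun F h hh hF hFh => ?_⟩
  have h1 : ∫ z, F z ∂ρ = ∫ y : Y, F y ∂σ := by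
    rw [← hjm.integral_map, hjm.map_comap, setIntegral_eq_integral_of_forall_compl_eq_zero]
    intro z hz
    rw [OnePoint.notMem_range_coe_iff] at hz
    rw [hz, hF]
  rw [h1, integral_map hg.aemeasurable hh.aestronglyMeasurable,
    integral_withDensity_eq_integral_toReal_smul hW (ae_of_all _ fun _ => ENNReal.ofReal_lt_top)]
  refine integral_congr_ae (ae_of_all _ fun y => ?_)
  simp only [W, smul_eq_mul, hFh, ENNReal.toReal_ofReal (hw0 y)]

/-- Riesz representation of a functional `L` on `C_κ(E)` which factors, with a bound, through
continuous functions vanishing at infinity on a locally compact space `Y`. -/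
theorem exists_measures_of_bound {κ : C(E, ℝ)}
    {g : Y → E} (hg : Continuous g) {w : Y → ℝ} (hw : Continuous w) (hw0 : ∀ y, 0 ≤ w y) {A : ℝ}
    (hwA : ∀ y, w y ≤ A)
    (hlim : ∀ φ : WeightedCont κ,
      Tendsto (fun y => w y * (κ (g y) * φ (g y))) (coclosedCompact Y) (𝓝 0))
    (L : WeightedCont κ →ₗ[ℝ] ℝ) {c : ℝ} (hc : 0 ≤ c)
    (hL : ∀ (φ : WeightedCont κ) (M : ℝ), 0 ≤ M → (∀ y, |w y * (κ (g y) * φ (g y))| ≤ M) →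
      L φ ≤ c * M) :
    ∃ p q : Measure E, IsFiniteMeasure p ∧ IsFiniteMeasure q ∧ CompactApprox p ∧ CompactApprox q ∧
      ∀ φ, L φ = ∫ x, κ x * φ x ∂p - ∫ x, κ x * φ x ∂q := by
  let _ : MeasurableSpace (OnePoint Y) := borel _
  have : BorelSpace (OnePoint Y) := ⟨rfl⟩
  let J : WeightedCont κ →ₗ[ℝ] C(OnePoint Y, ℝ) :=
    { toFun := fun φ => ⟨fun z => z.elim 0 fun y => w y * (κ (g y) * φ (g y)), by
        rw [OnePoint.continuous_iff]
        exact ⟨hlim φ, hw.mul ((κ.continuous.comp hg).mul (φ.continuous.comp hg))⟩⟩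
      map_add' := fun φ ψ => by
        ext z
        induction z using OnePoint.rec with
        | infty => simp
        | coe y =>
          change w y * (κ (g y) * (φ (g y) + ψ (g y))) = w y * (κ (g y) * φ (g y))
            + w y * (κ (g y) * ψ (g y))
          ring
      map_smul' := fun r φ => by
        ext z
        induction z using OnePoint.rec with
        | infty => simp
        | coe y =>
          change w y * (κ (g y) * (r * φ (g y))) = r * (w y * (κ (g y) * φ (g y)))
          ring }
  obtain ⟨Φ, Ψ, hΦ, hΨ, hLJ⟩ := ContinuousMap.exists_pos_sub_of_le_norm J L hc fun φ =>
    hL φ _ (norm_nonneg _) fun y => (J φ).norm_coe_le_norm (y : OnePoint Y)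
  obtain ⟨ρ, hρ, hρ', hρΦ⟩ := ContinuousMap.exists_regular_measure Φ hΦ
  obtain ⟨τ, hτ, hτ', hτΨ⟩ := ContinuousMap.exists_regular_measure Ψ hΨ
  obtain ⟨p, hp, hp', hpρ⟩ := exists_compactApprox_of_onePoint hg hw hw0 hwA ρ
  obtain ⟨q, hq, hq', hqτ⟩ := exists_compactApprox_of_onePoint hg hw hw0 hwA τ
  refine ⟨p, q, hp, hq, hp', hq', fun φ => ?_⟩
  have hcont : Continuous fun x => κ x * φ x := κ.continuous.mul φ.continuous
  rw [hLJ, hρΦ, hτΨ, hpρ (J φ) _ hcont rfl fun y => rfl, hqτ (J φ) _ hcont rfl fun y => rfl]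

end Representation

namespace WeightedCont

variable {E : Type*} [TopologicalSpace E] {κ : C(E, ℝ)}

theorem integrable_mul [MeasurableSpace E] [OpensMeasurableSpace E] (φ : WeightedCont κ)
    (p : Measure E) [IsFiniteMeasure p] : Integrable (fun x => κ x * φ x) p := by
  obtain ⟨M, hM⟩ := φ.exists_bound
  exact Integrable.of_bound (κ.continuous.mul φ.continuous).aestronglyMeasurable M
    (ae_of_all _ hM)

/-- Riesz representation for the mixed topology: a functional bounded by a seminorm of the mixed
topology is integration of `κ φ` against a signed measure approximated by compact sets, given here
by its Jordan decomposition. The compact sets `C_n` of the seminorm enter through their disjoint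
union, on which the functions `a_n κ φ` vanish at infinity. -/
theorem exists_measures_of_le_mixedSeminorm [T2Space E] [MeasurableSpace E] [BorelSpace E]
    (i : MixedIndex E) (L : WeightedCont κ →ₗ[ℝ] ℝ) {c : ℝ} (hc : 0 ≤ c)
    (hL : ∀ φ, L φ ≤ c * mixedSeminorm κ i φ) :
    ∃ p q : Measure E, IsFiniteMeasure p ∧ IsFiniteMeasure q ∧ p ⟂ₘ q ∧ CompactApprox (p + q) ∧
      ∀ φ, L φ = ∫ x, κ x * φ x ∂p - ∫ x, κ x * φ x ∂q := by
  have hcs : ∀ n, CompactSpace (i.C n) := fun n => isCompact_iff_compactSpace.1 (i.isCompact_C n)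
  have : WeaklyLocallyCompactSpace (Σ n, i.C n) := ⟨fun ⟨n, x⟩ =>
    ⟨Set.range (Sigma.mk n), isCompact_range continuous_sigmaMk,
      isOpen_range_sigmaMk.mem_nhds ⟨x, rfl⟩⟩⟩
  obtain ⟨A, hA⟩ := i.tendsto_a.bddAbove_range
  have hlim : ∀ φ : WeightedCont κ, Tendsto (fun y : Σ n, i.C n => i.a y.1 * (κ y.2 * φ y.2))
      (coclosedCompact _) (𝓝 0) := by
    intro φ
    obtain ⟨M, hM⟩ := φ.exists_bound
    rw [Metric.tendsto_nhds]
    intro ε hε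
    have ha : Tendsto (fun n => i.a n * M) atTop (𝓝 0) := by
      simpa using i.tendsto_a.mul_const M
    obtain ⟨N, hN⟩ := eventually_atTop.1 (ha.eventually_lt_const hε)
    have hK : IsCompact (⋃ n ∈ Finset.range N, Set.range (Sigma.mk (β := fun n => i.C n) n)) :=
      (Finset.range N).isCompact_biUnion fun n _ => isCompact_range continuous_sigmaMk
    filter_upwards [hK.compl_mem_coclosedCompact_of_isClosed hK.isClosed] with y hy
    have hyN : N ≤ y.1 := by
      by_contra hlt
      exact hy (Set.mem_biUnion (Finset.mem_coe.2 (Finset.mem_range.2 (not_le.1 hlt))) ⟨y.2, rfl⟩)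
    rw [Real.dist_eq, sub_zero, abs_mul, abs_of_pos (i.a_pos _)]
    exact (mul_le_mul_of_nonneg_left (hM _) (i.a_pos _).le).trans_lt (hN _ hyN)
  have hbd : ∀ (φ : WeightedCont κ) (M : ℝ), 0 ≤ M →
      (∀ y : Σ n, i.C n, |i.a y.1 * (κ y.2 * φ y.2)| ≤ M) → L φ ≤ c * M := by
    intro φ M hM0 hM
    refine (hL φ).trans (mul_le_mul_of_nonneg_left ?_ hc)
    refine mixedValue_le i φ hM0 fun n x hx => ?_
    have := hM ⟨n, x, hx⟩
    rwa [abs_mul, abs_of_pos (i.a_pos _)] at this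
  obtain ⟨p, q, hp, hq, hp', hq', h⟩ := exists_measures_of_bound (Y := Σ n, i.C n) (κ := κ)
    (g := fun y => (y.2 : E)) (continuous_sigma fun n => continuous_subtype_val)
    (w := fun y => i.a y.1)
    (continuous_sigma fun n => (continuous_const : Continuous fun _ : i.C n => i.a n))
    (fun y => (i.a_pos y.1).le) (fun y => hA ⟨y.1, rfl⟩) hlim L hc hbd
  refine ⟨p - q, q - p, isFiniteMeasure_of_le p Measure.sub_le,
      isFiniteMeasure_of_le q Measure.sub_le, Measure.mutually_singular_measure_sub,
      (hp'.mono Measure.sub_le).add (hq'.mono Measure.sub_le), fun φ => ?_⟩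
  rw [h, integral_sub_integral_eq_jordan p q _ (φ.integrable_mul p) (φ.integrable_mul q)]

end WeightedCont

/-! ### Jordan parts as suprema over continuous functions -/

section JordanSup

variable {E : Type*} [TopologicalSpace E] [MeasurableSpace E] [BorelSpace E]

theorem integrable_of_mem_unitInterval {f : C(E, ℝ)} (h0 : ∀ x, 0 ≤ f x) (h1 : ∀ x, f x ≤ 1)
    (p : Measure E) [IsFiniteMeasure p] : Integrable f p :=
  Integrable.of_bound f.continuous.aestronglyMeasurable 1
    (ae_of_all _ fun x => by rw [Real.norm_of_nonneg (h0 x)]; exact h1 x)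

theorem integral_le_measureReal {f : C(E, ℝ)} (h0 : ∀ x, 0 ≤ f x) (h1 : ∀ x, f x ≤ 1)
    {S : Set E} (hS : MeasurableSet S) (hf : ∀ x ∉ S, f x = 0) (p : Measure E)
    [IsFiniteMeasure p] : ∫ x, f x ∂p ≤ p.real S := by
  rw [← integral_indicator_one hS]
  refine integral_mono (integrable_of_mem_unitInterval h0 h1 p)
    ((integrable_const (1 : ℝ)).indicator hS) fun x => ?_
  by_cases hx : x ∈ S
  · simpa [hx] using h1 x
  · simp [hx, hf x hx]

theorem measureReal_le_integral {f : C(E, ℝ)} (h0 : ∀ x, 0 ≤ f x) (h1 : ∀ x, f x ≤ 1)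
    {S : Set E} (hS : MeasurableSet S) (hf : ∀ x ∈ S, f x = 1) (p : Measure E)
    [IsFiniteMeasure p] : p.real S ≤ ∫ x, f x ∂p := by
  rw [← integral_indicator_one hS]
  refine integral_mono ((integrable_const (1 : ℝ)).indicator hS)
    (integrable_of_mem_unitInterval h0 h1 p) fun x => ?_
  by_cases hx : x ∈ S
  · simp [hx, hf x hx]
  · simpa [hx] using h0 x

/-- The positive part `p` of `p - q` on an open set `U` is recovered, up to `η`, by testing `p - q`
against a continuous function supported in `U` with values in `[0, 1]`. The test function separates
compact subsets of `U` that nearly carry `p` and `q`. -/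
theorem exists_continuousMap_measureReal_le [CompletelyRegularSpace E] [T2Space E] {p q : Measure E} [IsFiniteMeasure p]
    [IsFiniteMeasure q] (hpq : p ⟂ₘ q) (hca : CompactApprox (p + q)) {U : Set E} (hU : IsOpen U)
    {η : ℝ} (hη : 0 < η) :
    ∃ f : C(E, ℝ), (∀ x, 0 ≤ f x) ∧ (∀ x, f x ≤ 1) ∧ (∀ x ∉ U, f x = 0) ∧
      p.real U ≤ ∫ x, f x ∂p - ∫ x, f x ∂q + η := by
  obtain ⟨s, hs, hps, hqs⟩ := hpq
  have hη' : (0 : ℝ≥0∞) < ENNReal.ofReal (η / 2) := ENNReal.ofReal_pos.2 (by positivity)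
  obtain ⟨A, hAU, hA, hAlt⟩ := hca (U \ s) (hU.measurableSet.diff hs) _ hη'
  obtain ⟨B, hBU, hB, hBlt⟩ := hca (U ∩ s) (hU.measurableSet.inter hs) _ hη'
  obtain ⟨f, h0, h1, hfA, hfF⟩ := hA.exists_continuousMap_one_of_isClosed
    (F := Uᶜ ∪ B) (hU.isClosed_compl.union hB.isClosed) (by
      rw [Set.disjoint_left]
      rintro x hxA (hxU | hxB)
      · exact hxU (hAU hxA).1
      · exact (hAU hxA).2 (hBU hxB).2)
  have hpA : p.real U ≤ p.real A + η / 2 := by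
    have h : p U ≤ p A + ENNReal.ofReal (η / 2) := by
      have hsub : U ⊆ (A ∪ ((U \ s) \ A)) ∪ s := fun x hx => by
        by_cases h1 : x ∈ s
        · exact Or.inr h1
        · by_cases h2 : x ∈ A
          · exact Or.inl (Or.inl h2)
          · exact Or.inl (Or.inr ⟨⟨hx, h1⟩, h2⟩)
      calc p U ≤ p A + p ((U \ s) \ A) + p s :=
            (measure_mono hsub).trans ((measure_union_le _ _).trans
              (add_le_add (measure_union_le _ _) le_rfl))
        _ ≤ p A + ENNReal.ofReal (η / 2) := by
            rw [hps, add_zero]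
            exact add_le_add le_rfl ((Measure.le_add_right le_rfl _).trans hAlt.le)
    have h2 := ENNReal.toReal_mono (by finiteness) h
    rwa [ENNReal.toReal_add (by finiteness) (by finiteness),
      ENNReal.toReal_ofReal (by positivity)] at h2
  have hqB : q.real (U \ B) ≤ η / 2 := by
    have h : q (U \ B) ≤ ENNReal.ofReal (η / 2) := by
      have hsub : U \ B ⊆ ((U ∩ s) \ B) ∪ sᶜ := fun x hx => by
        by_cases h1 : x ∈ s
        · exact Or.inl ⟨⟨hx.1, h1⟩, hx.2⟩
        · exact Or.inr h1
      calc q (U \ B) ≤ q ((U ∩ s) \ B) + q sᶜ :=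
            (measure_mono hsub).trans (measure_union_le _ _)
        _ ≤ ENNReal.ofReal (η / 2) := by
            rw [hqs, add_zero]
            exact (Measure.le_add_left le_rfl _).trans hBlt.le
    have h2 := ENNReal.toReal_mono (by finiteness) h
    rwa [ENNReal.toReal_ofReal (by positivity)] at h2
  have hfp := measureReal_le_integral h0 h1 hA.measurableSet hfA p
  have hfq := integral_le_measureReal h0 h1 (hU.measurableSet.diff hB.measurableSet)
    (S := U \ B) (fun x hx => hfF x (by
      by_cases hxU : x ∈ U
      · exact Or.inr (by_contra fun hxB => hx ⟨hxU, hxB⟩)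
      · exact Or.inl hxU)) q
  exact ⟨f, h0, h1, fun x hx => hfF x (Or.inl hx), by linarith⟩

end JordanSup

namespace WeightedCont

variable {E : Type*} [TopologicalSpace E] {κ : C(E, ℝ)}

/-- The element `f / κ` of `C_κ(E)`, for a continuous function `f` with values in `[0, 1]`. -/
noncomputable def ofUnit (hκ : ∀ x, 0 < κ x) (f : C(E, ℝ)) (h0 : ∀ x, 0 ≤ f x)
    (h1 : ∀ x, f x ≤ 1) : WeightedCont κ :=
  ⟨⟨fun x => f x / κ x, f.continuous.div κ.continuous fun x => (hκ x).ne'⟩, 1, fun x => by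
    change |κ x * (f x / κ x)| ≤ 1
    rw [mul_div_cancel₀ _ (hκ x).ne', abs_of_nonneg (h0 x)]
    exact h1 x⟩

theorem mul_ofUnit_apply (hκ : ∀ x, 0 < κ x) (f : C(E, ℝ)) (h0 : ∀ x, 0 ≤ f x)
    (h1 : ∀ x, f x ≤ 1) (x : E) : κ x * ofUnit hκ f h0 h1 x = f x :=
  mul_div_cancel₀ _ (hκ x).ne'

variable [CompletelyRegularSpace E] [T2Space E] [MeasurableSpace E] [BorelSpace E]

/-- The total variation `p + q` of a representing measure is bounded on an open set `U` by the values
of the functional on functions supported in `U`. -/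
theorem measure_le_of_forall_le (hκ : ∀ x, 0 < κ x) {p q : Measure E} [IsFiniteMeasure p]
    [IsFiniteMeasure q] (hpq : p ⟂ₘ q) (hca : CompactApprox (p + q)) {L : WeightedCont κ →ₗ[ℝ] ℝ}
    (hL : ∀ φ, L φ = ∫ x, κ x * φ x ∂p - ∫ x, κ x * φ x ∂q) {U : Set E} (hU : IsOpen U) {c : ℝ}
    (hc : ∀ φ : WeightedCont κ, (∀ x, |κ x * φ x| ≤ 1) → (∀ x ∉ U, φ x = 0) → |L φ| ≤ c) :
    (p + q) U ≤ 2 * ENNReal.ofReal c := by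
  have key : ∀ f : C(E, ℝ), (∀ x, 0 ≤ f x) → (∀ x, f x ≤ 1) → (∀ x ∉ U, f x = 0) →
      |∫ x, f x ∂p - ∫ x, f x ∂q| ≤ c := by
    intro f h0 h1 hf
    have h := hc (ofUnit hκ f h0 h1)
      (fun x => by rw [mul_ofUnit_apply, abs_of_nonneg (h0 x)]; exact h1 x)
      (fun x hx => by change f x / κ x = 0; rw [hf x hx, zero_div])
    rw [hL] at h
    simpa only [mul_ofUnit_apply] using h
  have hp : p.real U ≤ c := le_of_forall_pos_le_add fun η hη => by
    obtain ⟨f, h0, h1, hfU, hf⟩ := exists_continuousMap_measureReal_le hpq hca hU hη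
    have := (abs_le.1 (key f h0 h1 hfU)).2
    linarith
  have hq : q.real U ≤ c := le_of_forall_pos_le_add fun η hη => by
    obtain ⟨f, h0, h1, hfU, hf⟩ :=
      exists_continuousMap_measureReal_le hpq.symm (add_comm p q ▸ hca) hU hη
    have := (abs_le.1 (key f h0 h1 hfU)).1
    linarith
  rw [Measure.add_apply, two_mul, ← ofReal_measureReal, ← ofReal_measureReal]
  exact add_le_add (ENNReal.ofReal_le_ofReal hp) (ENNReal.ofReal_le_ofReal hq)

/-- If the functionals `φ ↦ ∫ κ φ d(p x - q x)` depend continuously on `x`, then the positive part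
`p x` is lower semicontinuous in `x` on open sets, hence depends measurably on `x`. -/
theorem measurable_posPart {X : Type*} [TopologicalSpace X] [MeasurableSpace X] [BorelSpace X]
    (hκ : ∀ x, 0 < κ x) {p q : X → Measure E} [∀ x, IsFiniteMeasure (p x)]
    [∀ x, IsFiniteMeasure (q x)] (hpq : ∀ x, p x ⟂ₘ q x) (hca : ∀ x, CompactApprox (p x + q x))
    (hL : ∀ φ : WeightedCont κ,
      Continuous fun x => ∫ y, κ y * φ y ∂(p x) - ∫ y, κ y * φ y ∂(q x)) :
    Measurable p := by
  have hopen : ∀ U : Set E, IsOpen U → Measurable fun x => p x U := by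
    intro U hU
    have hlsc : LowerSemicontinuous fun x => (p x).real U := by
      intro x r hr
      obtain ⟨f, h0, h1, hfU, hf⟩ := exists_continuousMap_measureReal_le (hpq x) (hca x) hU
        (η := ((p x).real U - r) / 2) (by linarith)
      have hcont := hL (ofUnit hκ f h0 h1)
      simp only [mul_ofUnit_apply] at hcont
      have hlt : r < ∫ y, f y ∂(p x) - ∫ y, f y ∂(q x) := by linarith
      filter_upwards [hcont.continuousAt.eventually_const_lt hlt] with z hz
      have hpz := integral_le_measureReal h0 h1 hU.measurableSet hfU (p z)
      have hqz : 0 ≤ ∫ y, f y ∂(q z) := integral_nonneg h0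
      linarith
    have h := hlsc.measurable.ennreal_ofReal
    have he : ∀ x, ENNReal.ofReal ((p x).real U) = p x U := fun x => ofReal_measureReal
    simpa only [he] using h
  refine Measurable.measure_of_isPiSystem (BorelSpace.measurable_eq (α := E)) isPiSystem_isOpen
    hopen (hopen _ isOpen_univ)

end WeightedCont

/-! ### Elements of `M_κ(E)` from finite measures -/

section DivWeight

variable {E : Type*} [TopologicalSpace E] [MeasurableSpace E] {κ : C(E, ℝ)}

theorem measurable_ofReal_weight [OpensMeasurableSpace E] : Measurable fun y => ENNReal.ofReal (κ y) :=
  κ.continuous.measurable.ennreal_ofReal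

theorem measurable_ofReal_weight_inv [OpensMeasurableSpace E] : Measurable fun y => ENNReal.ofReal (κ y)⁻¹ :=
  κ.continuous.measurable.inv.ennreal_ofReal

theorem divWeight_add (ρ σ : Measure E) :
    divWeight κ (ρ + σ) = divWeight κ ρ + divWeight κ σ :=
  withDensity_add_measure _ _ _

theorem divWeight_withDensity [OpensMeasurableSpace E] (hκ : ∀ x, 0 < κ x) (ρ : Measure E) :
    divWeight κ (ρ.withDensity fun y => ENNReal.ofReal (κ y)) = ρ := by
  rw [divWeight, ← withDensity_mul _ measurable_ofReal_weight measurable_ofReal_weight_inv]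
  have h : ((fun y => ENNReal.ofReal (κ y)) * fun y => ENNReal.ofReal (κ y)⁻¹) = 1 := by
    funext y
    simp only [Pi.mul_apply, Pi.one_apply]
    rw [← ENNReal.ofReal_mul (hκ y).le, mul_inv_cancel₀ (hκ y).ne', ENNReal.ofReal_one]
  rw [h, withDensity_one]

theorem divWeight_univ (ρ : Measure E) :
    divWeight κ ρ Set.univ = ∫⁻ y, ENNReal.ofReal (κ y)⁻¹ ∂ρ := by
  rw [divWeight, withDensity_apply _ MeasurableSet.univ, Measure.restrict_univ]

namespace WeightedMeasure

/-- The element `κ · (p - q)` of `M_κ(E)`, for finite mutually singular `p` and `q`. -/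
noncomputable def ofFinite [OpensMeasurableSpace E] (hκ : ∀ x, 0 < κ x) (p q : Measure E) [IsFiniteMeasure p]
    [IsFiniteMeasure q] (hpq : p ⟂ₘ q) (hca : CompactApprox (p + q)) : WeightedMeasure κ where
  pos := p.withDensity fun y => ENNReal.ofReal (κ y)
  neg := q.withDensity fun y => ENNReal.ofReal (κ y)
  mutuallySingular := hpq.mono_ac (withDensity_absolutelyContinuous _ _)
    (withDensity_absolutelyContinuous _ _)
  lintegral_lt_top := by
    rw [← divWeight_univ, divWeight_add, divWeight_withDensity hκ, divWeight_withDensity hκ]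
    exact measure_lt_top _ _
  radon := by
    rw [divWeight_add, divWeight_withDensity hκ, divWeight_withDensity hκ]
    exact hca

section

variable [OpensMeasurableSpace E] (hκ : ∀ x, 0 < κ x) (p q : Measure E) [IsFiniteMeasure p]
  [IsFiniteMeasure q] (hpq : p ⟂ₘ q) (hca : CompactApprox (p + q))

theorem divWeight_variation_ofFinite :
    divWeight κ (ofFinite hκ p q hpq hca).variation = p + q := by
  change divWeight κ (_ + _) = _
  rw [divWeight_add]
  exact congrArg₂ _ (divWeight_withDensity hκ p) (divWeight_withDensity hκ q)

theorem integral_ofFinite (φ : WeightedCont κ) :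
    (ofFinite hκ p q hpq hca).integral φ = ∫ x, κ x * φ x ∂p - ∫ x, κ x * φ x ∂q := by
  have h : ∀ ρ : Measure E, ∫ x, φ x ∂(ρ.withDensity fun y => ENNReal.ofReal (κ y))
      = ∫ x, κ x * φ x ∂ρ := fun ρ => by
    rw [integral_withDensity_eq_integral_toReal_smul measurable_ofReal_weight
      (ae_of_all _ fun _ => ENNReal.ofReal_lt_top)]
    simp only [ENNReal.toReal_ofReal (hκ _).le, smul_eq_mul]
  exact congrArg₂ _ (h p) (h q)

end

theorem integral_dirac [T2Space E] [BorelSpace E] (φ : WeightedCont κ) (x : E) :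
    (dirac κ x).integral φ = φ x := by
  change ∫ y, φ y ∂(Measure.dirac x) - ∫ y, φ y ∂(0 : Measure E) = φ x
  rw [MeasureTheory.integral_dirac, integral_zero_measure, sub_zero]

/-- Convergence in the narrow topology is convergence of the integrals of all `φ ∈ C_κ(E)`. -/
theorem tendsto_nhds_iff {ι : Type*} {l : Filter ι} {m : ι → WeightedMeasure κ}
    {μ : WeightedMeasure κ} :
    Tendsto m l (𝓝 μ) ↔ ∀ φ, Tendsto (fun i => (m i).integral φ) l (𝓝 (μ.integral φ)) := by
  rw [narrowTopology, nhds_iInf, tendsto_iInf]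
  refine forall_congr' fun φ => ?_
  rw [nhds_induced, tendsto_comap_iff]
  rfl

theorem measurable_value {X : Type*} [MeasurableSpace X] {m : X → WeightedMeasure κ}
    (hpos : Measurable fun x => (m x).pos) (hneg : Measurable fun x => (m x).neg) {B : Set E}
    (hB : MeasurableSet B) : Measurable fun x => (m x).value B := by
  have h : (fun x => (m x).value B) = fun x =>
      (((m x).pos B : ℝ≥0∞) : EReal) + -(((m x).neg B : ℝ≥0∞) : EReal) := by
    funext x; exact sub_eq_add_neg _ _
  rw [h]
  exact ((Measure.measurable_coe hB).comp hpos).coe_ereal_ennreal.add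
    (continuous_neg.measurable.comp
      ((Measure.measurable_coe hB).comp hneg).coe_ereal_ennreal)

end WeightedMeasure

end DivWeight

theorem measurable_withDensity_const {E X : Type*} [MeasurableSpace E] [MeasurableSpace X] {p : X → Measure E}
    (hp : Measurable p) {w : E → ℝ≥0∞} (hw : Measurable w) :
    Measurable fun x => (p x).withDensity w := by
  refine Measure.measurable_of_measurable_coe _ fun B hB => ?_
  simp only [withDensity_apply _ hB]
  simp_rw [← lintegral_indicator hB]
  exact (Measure.measurable_lintegral (hw.indicator hB)).comp hp

/-! ### From a `C₀`-semigroup to its kernels -/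

section MixedBounds

variable {E : Type*} [TopologicalSpace E] {κ : C(E, ℝ)}

/-- The seminorm index with constant compact set `K`. -/
noncomputable def MixedIndex.const (K : Set E) (hK : IsCompact K) : MixedIndex E where
  C := fun _ => K
  isCompact_C := fun _ => hK
  a := fun n => 1 / ((n : ℝ) + 1)
  a_pos := fun n => by positivity
  tendsto_a := tendsto_one_div_add_atTop_nhds_zero_nat

theorem abs_le_mixedSeminorm_const {K : Set E} (hK : IsCompact K) (φ : WeightedCont κ) {x : E}
    (hx : x ∈ K) : |κ x * φ x| ≤ mixedSeminorm κ (MixedIndex.const K hK) φ := by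
  have h := le_mixedValue (MixedIndex.const K hK) φ 0 x hx
  have ha : (MixedIndex.const K hK).a 0 = 1 := by simp [MixedIndex.const]
  rwa [ha, one_mul] at h

/-- For linear operators, equicontinuity on `[0, T]` is a bound between seminorms. -/
theorem exists_mixedSeminorm_le {P : ℝ≥0 → WeightedCont κ →ₗ[ℝ] WeightedCont κ}
    (hP : IsC0Semigroup κ (fun t φ => P t φ)) (T : ℝ≥0) (i : MixedIndex E) :
    ∃ j : MixedIndex E, ∃ c : ℝ, 0 ≤ c ∧ ∀ t ≤ T, ∀ φ,
      mixedSeminorm κ i (P t φ) ≤ c * mixedSeminorm κ j φ := by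
  obtain ⟨j, δ, hδ, h⟩ := hP.locally_equicontinuous T 1 one_pos i
  refine ⟨j, δ⁻¹, by positivity, fun t ht φ => ?_⟩
  rw [inv_mul_eq_div, le_div_iff₀ hδ]
  refine le_of_forall_gt_imp_ge_of_dense fun r hr => ?_
  have hr0 : 0 < r := (apply_nonneg _ _).trans_lt hr
  -- Rescale `φ` so that its seminorm drops below `δ`.
  have hs : mixedSeminorm κ j ((δ / r) • φ - 0) < δ := by
    rw [sub_zero, map_smul_eq_mul, Real.norm_of_nonneg (by positivity), div_mul_eq_mul_div,
      div_lt_iff₀ hr0]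
    exact mul_lt_mul_of_pos_left hr hδ
  have h1 := h t ht _ _ hs
  simp only [map_zero, sub_zero, map_smul] at h1
  rw [map_smul_eq_mul, Real.norm_of_nonneg (by positivity), div_mul_eq_mul_div,
    div_lt_one hr0] at h1
  linarith

/-- The operators are uniformly bounded on `[0, T]` in the weighted supremum norm: otherwise the
points where the bound fails define a seminorm of the mixed topology which is unbounded on the unit
ball. -/
theorem exists_weighted_bound {P : ℝ≥0 → WeightedCont κ →ₗ[ℝ] WeightedCont κ}
    (hP : IsC0Semigroup κ (fun t φ => P t φ)) (T : ℝ≥0) :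
    ∃ N : ℝ, ∀ t ≤ T, ∀ φ : WeightedCont κ, (∀ x, |κ x * φ x| ≤ 1) →
      ∀ x, |κ x * P t φ x| ≤ N := by
  by_contra! hcon
  choose t ht φ hφ x hx using fun n : ℕ => hcon (((n : ℝ) + 1) ^ 2)
  let i : MixedIndex E :=
    { C := fun n => {x n}
      isCompact_C := fun n => isCompact_singleton
      a := fun n => 1 / ((n : ℝ) + 1)
      a_pos := fun n => by positivity
      tendsto_a := tendsto_one_div_add_atTop_nhds_zero_nat }
  obtain ⟨j, c, hc, hle⟩ := exists_mixedSeminorm_le hP T i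
  obtain ⟨A, hA⟩ := j.tendsto_a.bddAbove_range
  have hA0 : 0 ≤ A := (j.a_pos 0).le.trans (hA ⟨0, rfl⟩)
  obtain ⟨n, hn⟩ := exists_nat_gt (c * A)
  have h1 : mixedSeminorm κ j (φ n) ≤ A := mixedValue_le j _ hA0 fun m y _ =>
    (mul_le_mul (hA ⟨m, rfl⟩) (hφ n y) (abs_nonneg _) hA0).trans_eq (mul_one A)
  have h2 : 1 / ((n : ℝ) + 1) * |κ (x n) * P (t n) (φ n) (x n)| ≤ c * A :=
    (le_mixedValue i (P (t n) (φ n)) n (x n) rfl).trans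
      ((hle _ (ht n) _).trans (mul_le_mul_of_nonneg_left h1 hc))
  have h3 : (n : ℝ) + 1 ≤ 1 / ((n : ℝ) + 1) * |κ (x n) * P (t n) (φ n) (x n)| := by
    rw [one_div_mul_eq_div, le_div_iff₀ (by positivity)]
    nlinarith [hx n]
  linarith

end MixedBounds

section Forward

variable {E : Type*} [TopologicalSpace E] [CompletelyRegularSpace E] [T2Space E]
    [MeasurableSpace E] [BorelSpace E] {κ : C(E, ℝ)}

namespace WeightedCont

/-- The linear functional `φ ↦ (S φ) x`. -/
noncomputable def evalLin (S : WeightedCont κ →ₗ[ℝ] WeightedCont κ) (x : E) :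
    WeightedCont κ →ₗ[ℝ] ℝ where
  toFun φ := S φ x
  map_add' φ ψ := by rw [map_add]; rfl
  map_smul' c φ := by rw [map_smul]; rfl

/-- `measure_le_of_forall_le` for the functional `φ ↦ (S φ) x`, scaled by the weight at `x`. -/
theorem ofReal_smul_measure_le (hκ : ∀ x, 0 < κ x) {p q : Measure E} [IsFiniteMeasure p]
    [IsFiniteMeasure q] (hpq : p ⟂ₘ q) (hca : CompactApprox (p + q))
    {S : WeightedCont κ →ₗ[ℝ] WeightedCont κ} {x : E}
    (hS : ∀ φ, S φ x = ∫ y, κ y * φ y ∂p - ∫ y, κ y * φ y ∂q) {U : Set E} (hU : IsOpen U) {c : ℝ}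
    (hc : ∀ φ : WeightedCont κ, (∀ y, |κ y * φ y| ≤ 1) → (∀ y ∉ U, φ y = 0) →
      |κ x * S φ x| ≤ c) :
    ENNReal.ofReal (κ x) * (p + q) U ≤ 2 * ENNReal.ofReal c := by
  have h := measure_le_of_forall_le hκ hpq hca (L := evalLin S x) hS hU (c := c / κ x)
    fun φ h1 h2 => by
      have := hc φ h1 h2
      rw [abs_mul, abs_of_pos (hκ x)] at this
      rw [le_div_iff₀ (hκ x), mul_comm]
      exact this
  calc ENNReal.ofReal (κ x) * (p + q) U
      ≤ ENNReal.ofReal (κ x) * (2 * ENNReal.ofReal (c / κ x)) := by gcongr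
    _ = 2 * ENNReal.ofReal c := by
        rw [mul_left_comm, ← ENNReal.ofReal_mul (hκ x).le, mul_div_cancel₀ _ (hκ x).ne']

end WeightedCont

theorem exists_kernels_of_isC0Semigroup (hκ : ∀ x, 0 < κ x)
    {P : ℝ≥0 → WeightedCont κ →ₗ[ℝ] WeightedCont κ}
    (hP : IsC0Semigroup κ (fun t φ => P t φ)) :
    ∃ μ : ℝ≥0 → E → WeightedMeasure κ,
      (∀ t, ∀ B : Set E, MeasurableSet B → Measurable fun x => (μ t x).value B) ∧
      (∀ t φ x, P t φ x = (μ t x).integral φ) ∧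
      (∀ T : ℝ≥0, (⨆ t ≤ T, ⨆ x : E,
        ENNReal.ofReal (κ x) * ∫⁻ y, ENNReal.ofReal (κ y)⁻¹ ∂(μ t x).variation) < ∞) ∧
      (∀ T : ℝ≥0, ∀ C : Set E, IsCompact C →
        IsTightMeasureSet {ρ : Measure E | ∃ x ∈ C, ∃ t ≤ T,
          ρ = ENNReal.ofReal (κ x) • divWeight κ (μ t x).variation}) ∧
      (∀ x : E, ∀ u : ℕ → E, Tendsto u atTop (𝓝 x) →
        Tendsto (fun p : ℝ≥0 × ℕ => μ p.1 (u p.2)) (𝓝 0 ×ˢ atTop)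
          (𝓝 (WeightedMeasure.dirac κ x))) := by
  have hrep : ∀ (t : ℝ≥0) (x : E), ∃ p q : Measure E, IsFiniteMeasure p ∧ IsFiniteMeasure q ∧
      p ⟂ₘ q ∧ CompactApprox (p + q) ∧
      ∀ φ, P t φ x = ∫ y, κ y * φ y ∂p - ∫ y, κ y * φ y ∂q := by
    intro t x
    obtain ⟨j, c, hc, hle⟩ := exists_mixedSeminorm_le hP t
      (MixedIndex.const {x} isCompact_singleton)
    refine WeightedCont.exists_measures_of_le_mixedSeminorm j (WeightedCont.evalLin (P t) x)
      (c := c / κ x) (div_nonneg hc (hκ x).le) fun φ => ?_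
    have h1 := (abs_le_mixedSeminorm_const isCompact_singleton (P t φ) rfl).trans (hle t le_rfl φ)
    rw [div_mul_eq_mul_div, le_div_iff₀ (hκ x), mul_comm]
    exact (le_abs_self _).trans h1
  choose p q hp hq hpq hca hPint using hrep
  let μ : ℝ≥0 → E → WeightedMeasure κ := fun t x =>
    WeightedMeasure.ofFinite hκ (p t x) (q t x) (hpq t x) (hca t x)
  have hvar : ∀ t x, divWeight κ (μ t x).variation = p t x + q t x := fun t x =>
    WeightedMeasure.divWeight_variation_ofFinite hκ _ _ _ _
  have hint : ∀ t φ x, P t φ x = (μ t x).integral φ := fun t φ x => by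
    rw [WeightedMeasure.integral_ofFinite, hPint]
  have hmeas : ∀ t, Measurable (p t) ∧ Measurable (q t) := by
    intro t
    have hcont : ∀ φ : WeightedCont κ,
        Continuous fun x => ∫ y, κ y * φ y ∂(p t x) - ∫ y, κ y * φ y ∂(q t x) := fun φ => by
      simp_rw [← hPint]
      exact (P t φ).continuous
    refine ⟨WeightedCont.measurable_posPart hκ (hpq t) (hca t) hcont,
      WeightedCont.measurable_posPart hκ (fun x => (hpq t x).symm)
        (fun x => add_comm (p t x) _ ▸ hca t x) fun φ => ?_⟩
    exact (hcont φ).neg.congr fun x => neg_sub _ _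
  refine ⟨μ, fun t B hB => ?_, hint, fun T => ?_, fun T C hC => ?_, fun x u hu => ?_⟩
  · exact WeightedMeasure.measurable_value
      (measurable_withDensity_const (hmeas t).1 measurable_ofReal_weight)
      (measurable_withDensity_const (hmeas t).2 measurable_ofReal_weight) hB
  · obtain ⟨N, hN⟩ := exists_weighted_bound hP T
    refine lt_of_le_of_lt (iSup₂_le fun t ht => iSup_le fun x => ?_)
      (ENNReal.mul_lt_top ENNReal.ofNat_lt_top ENNReal.ofReal_lt_top :
        2 * ENNReal.ofReal N < ∞)
    rw [← divWeight_univ, hvar]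
    exact WeightedCont.ofReal_smul_measure_le hκ (hpq t x) (hca t x) (hPint t x) isOpen_univ
      fun φ hφ _ => hN t ht φ hφ x
  · rw [isTightMeasureSet_iff_exists_isCompact_measure_compl_le]
    intro ε hε
    obtain ⟨r, hr0, hr⟩ := ENNReal.lt_iff_exists_nnreal_btwn.1 (ENNReal.half_pos hε.ne')
    obtain ⟨j, c, hc, hle⟩ := exists_mixedSeminorm_le hP T (MixedIndex.const C hC)
    -- Beyond the first `n₀` compact sets, the seminorm with index `j` weighs the unit ball by
    -- less than `r / c`.
    have hlim : Tendsto (fun n => c * j.a n) atTop (𝓝 0) := by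
      simpa using j.tendsto_a.const_mul c
    have hr0' : (0 : ℝ) < r := by exact_mod_cast hr0
    obtain ⟨n₀, hn₀⟩ := eventually_atTop.1 (hlim.eventually_lt_const hr0')
    have hK : IsCompact (⋃ n ∈ Finset.range n₀, j.C n) :=
      (Finset.range n₀).isCompact_biUnion fun n _ => j.isCompact_C n
    refine ⟨_, hK, ?_⟩
    rintro _ ⟨x, hx, t, ht, rfl⟩
    rw [hvar, Measure.smul_apply, smul_eq_mul]
    refine (WeightedCont.ofReal_smul_measure_le hκ (hpq t x) (hca t x) (hPint t x)
      hK.isClosed.isOpen_compl (c := r) fun φ hφ1 hφ0 => ?_).trans ?_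
    · refine (abs_le_mixedSeminorm_const hC (P t φ) hx).trans ((hle t ht φ).trans ?_)
      rcases hc.eq_or_lt with rfl | hc0
      · simp
      rw [← le_div_iff₀' hc0]
      refine mixedValue_le j φ (by positivity) fun n y hy => ?_
      rw [le_div_iff₀' hc0]
      by_cases hn : n < n₀
      · have hy0 : φ y = 0 := hφ0 y fun hyK =>
          hyK (Set.mem_biUnion (Finset.mem_coe.2 (Finset.mem_range.2 hn)) hy)
        simp [hy0]
      · calc c * (j.a n * |κ y * φ y|) ≤ c * (j.a n * 1) := by
              have := (j.a_pos n).le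
              gcongr
              exact hφ1 y
          _ ≤ r := by rw [mul_one]; exact (hn₀ n (not_lt.1 hn)).le
    · rw [ENNReal.ofReal_coe_nnreal]
      calc 2 * (r : ℝ≥0∞) ≤ 2 * (ε / 2) := by gcongr
        _ = ε := ENNReal.mul_div_cancel two_ne_zero ENNReal.ofNat_ne_top
  · rw [WeightedMeasure.tendsto_nhds_iff]
    intro φ
    simp only [← hint, WeightedMeasure.integral_dirac]
    -- Strong continuity controls `P t φ - φ` uniformly on the compact set formed by `u` and `x`.
    have hK := hu.isCompact_insert_range
    let i := MixedIndex.const _ hK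
    have h1 : Tendsto (fun t => mixedSeminorm κ i (P t φ - φ)) (𝓝 0) (𝓝 0) := by
      have hc : Continuous (mixedSeminorm κ i) :=
        (withSeminorms_mixedSeminorm κ).continuous_seminorm i
      have := ((withSeminorms_mixedSeminorm κ).tendsto_nhds _ φ).1 (hP.right_continuous φ) i
      rw [Metric.tendsto_nhds]
      intro ε hε
      filter_upwards [this ε hε] with t ht
      rwa [Real.dist_eq, sub_zero, abs_of_nonneg (apply_nonneg _ _)]
    have h2 : Tendsto (fun n => (κ (u n))⁻¹) atTop (𝓝 (κ x)⁻¹) :=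
      ((κ.continuous.tendsto x).comp hu).inv₀ (hκ x).ne'
    have h3 : Tendsto (fun z : ℝ≥0 × ℕ => mixedSeminorm κ i (P z.1 φ - φ) * (κ (u z.2))⁻¹)
        (𝓝 0 ×ˢ atTop) (𝓝 0) := by
      simpa using (h1.comp tendsto_fst).mul (h2.comp tendsto_snd)
    have h4 : Tendsto (fun z : ℝ≥0 × ℕ => P z.1 φ (u z.2) - φ (u z.2)) (𝓝 0 ×ˢ atTop) (𝓝 0) := by
      refine squeeze_zero_norm (fun z => ?_) h3
      rw [← div_eq_mul_inv, le_div_iff₀ (hκ _), Real.norm_eq_abs, mul_comm]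
      have := abs_le_mixedSeminorm_const hK (P z.1 φ - φ) (Set.mem_insert_of_mem x ⟨z.2, rfl⟩)
      rwa [abs_mul, abs_of_pos (hκ _)] at this
    have h5 : Tendsto (fun z : ℝ≥0 × ℕ => φ (u z.2)) (𝓝 0 ×ˢ atTop) (𝓝 (φ x)) :=
      ((φ.continuous.tendsto x).comp hu).comp tendsto_snd
    simpa using h4.add h5

end Forward

/-! ### From kernels to a `C₀`-semigroup -/

section Backward

variable {E : Type*} [TopologicalSpace E]

theorem WeightedMeasure.ofReal_abs_mul_integral_le [MeasurableSpace E] [OpensMeasurableSpace E]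
    {κ : C(E, ℝ)} (hκ : ∀ x, 0 < κ x) (m : WeightedMeasure κ) (φ : WeightedCont κ) (x : E) :
    ENNReal.ofReal |κ x * m.integral φ| ≤
      ∫⁻ y, ENNReal.ofReal |κ y * φ y| ∂(ENNReal.ofReal (κ x) • divWeight κ m.variation) := by
  have h1 : ENNReal.ofReal |m.integral φ| ≤ ∫⁻ y, ENNReal.ofReal |φ y| ∂m.variation := by
    simp only [← Real.enorm_eq_ofReal_abs]
    rw [WeightedMeasure.variation, lintegral_add_measure]
    refine (enorm_sub_le (a := ∫ y, φ y ∂m.pos) (b := ∫ y, φ y ∂m.neg)).trans ?_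
    exact add_le_add (enorm_integral_le_lintegral_enorm _) (enorm_integral_le_lintegral_enorm _)
  have h2 : ∫⁻ y, ENNReal.ofReal |κ y * φ y| ∂(divWeight κ m.variation)
      = ∫⁻ y, ENNReal.ofReal |φ y| ∂m.variation := by
    refine (lintegral_withDensity_eq_lintegral_mul _ measurable_ofReal_weight_inv
      (κ.continuous.mul φ.continuous).abs.measurable.ennreal_ofReal).trans
      (lintegral_congr fun y => ?_)
    change (_ * ENNReal.ofReal |κ y * φ y|) = _
    rw [← ENNReal.ofReal_mul (inv_nonneg.2 (hκ y).le), abs_mul, abs_of_pos (hκ y),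
      inv_mul_cancel_left₀ (hκ y).ne']
  rw [lintegral_smul_measure, h2, smul_eq_mul, abs_mul, abs_of_pos (hκ x),
    ENNReal.ofReal_mul (hκ x).le]
  gcongr

/-- A function bounded by `2 ^ j δ` on sets `K j` whose complements have mass at most `4 ^ (-j)` has
integral at most `δ (N + 4)`, where `N` bounds the total mass. -/
theorem lintegral_le_of_compl_le {X : Type*} [MeasurableSpace X] (ρ : Measure X) {N : ℝ≥0}
    (hN : ρ Set.univ ≤ N) {K : ℕ → Set X} (hKm : ∀ j, MeasurableSet (K j))
    (hK : ∀ j, ρ (K j)ᶜ ≤ (4⁻¹ : ℝ≥0∞) ^ j) {h : X → ℝ} {δ : ℝ} (hδ : 0 < δ)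
    (hh : ∀ j, ∀ y ∈ K j, h y ≤ 2 ^ j * δ) :
    ∫⁻ y, ENNReal.ofReal (h y) ∂ρ ≤ ENNReal.ofReal ((N + 4) * δ) := by
  let D := ENNReal.ofReal δ
  have hofReal : ∀ j : ℕ, ENNReal.ofReal (2 ^ j * δ) = 2 ^ j * D := fun j => by
    rw [ENNReal.ofReal_mul (by positivity), ENNReal.ofReal_pow (by norm_num)]
    simp [D]
  -- Compare at the first `j` with `y ∈ K j`; if there is none, the series has unbounded terms.
  have hpt : ∀ y, ENNReal.ofReal (h y) ≤
      D + ∑' j : ℕ, (K j)ᶜ.indicator (fun _ => (2 : ℝ≥0∞) ^ (j + 1) * D) y := by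
    intro y
    by_cases hy : ∃ j, y ∈ K j
    · classical
      have hmem := Nat.find_spec hy
      rcases hj : Nat.find hy with _ | j
      · rw [hj] at hmem
        refine le_add_right (ENNReal.ofReal_le_ofReal ?_)
        simpa using hh 0 y hmem
      · rw [hj] at hmem
        have hnot : y ∈ (K j)ᶜ := Nat.find_min hy (by omega)
        refine le_add_left (le_trans ?_ (ENNReal.le_tsum j))
        rw [Set.indicator_of_mem hnot, ← hofReal]
        exact ENNReal.ofReal_le_ofReal (hh _ y hmem)
    · push Not at hy
      obtain ⟨n, hn⟩ := pow_unbounded_of_one_lt (h y / δ) one_lt_two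
      refine le_add_left (le_trans ?_ (ENNReal.le_tsum n))
      rw [Set.indicator_of_mem (hy n : y ∈ (K n)ᶜ), ← hofReal]
      refine ENNReal.ofReal_le_ofReal ?_
      rw [div_lt_iff₀ hδ] at hn
      rw [pow_succ]
      nlinarith [pow_pos (two_pos : (0 : ℝ) < 2) n]
  have hgeom : ∀ j : ℕ, (2 : ℝ≥0∞) ^ (j + 1) * D * 4⁻¹ ^ j = 2 * D * 2⁻¹ ^ j := fun j => by
    have h4 : (4 : ℝ≥0∞)⁻¹ = 2⁻¹ * 2⁻¹ := by
      rw [← ENNReal.mul_inv (Or.inl two_ne_zero) (Or.inl ENNReal.ofNat_ne_top)]; norm_num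
    have h2 : (2 : ℝ≥0∞) ^ j * 2⁻¹ ^ j = 1 := by
      rw [← mul_pow, ENNReal.mul_inv_cancel two_ne_zero ENNReal.ofNat_ne_top, one_pow]
    calc (2 : ℝ≥0∞) ^ (j + 1) * D * 4⁻¹ ^ j = 2 * D * 2⁻¹ ^ j * (2 ^ j * 2⁻¹ ^ j) := by
          rw [h4, mul_pow]; ring
      _ = _ := by rw [h2, mul_one]
  calc ∫⁻ y, ENNReal.ofReal (h y) ∂ρ
      ≤ ∫⁻ y, (D + ∑' j : ℕ, (K j)ᶜ.indicator (fun _ => (2 : ℝ≥0∞) ^ (j + 1) * D) y) ∂ρ :=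
        lintegral_mono hpt
    _ = D * ρ Set.univ + ∑' j : ℕ, (2 : ℝ≥0∞) ^ (j + 1) * D * ρ (K j)ᶜ := by
        rw [lintegral_add_left measurable_const, lintegral_const, lintegral_tsum fun j =>
          (measurable_const.indicator (hKm j).compl).aemeasurable]
        simp only [lintegral_indicator_const (hKm _).compl]
    _ ≤ D * N + ∑' j : ℕ, 2 * D * 2⁻¹ ^ j := by
        refine add_le_add (by gcongr) (ENNReal.tsum_le_tsum fun j => ?_)
        rw [← hgeom]
        gcongr
        exact hK j
    _ = D * N + D * 4 := by
        rw [ENNReal.tsum_mul_left, ENNReal.tsum_geometric, ENNReal.one_sub_inv_two, inv_inv]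
        ring
    _ = ENNReal.ofReal ((N + 4) * δ) := by
        rw [← mul_add, mul_comm ((N : ℝ) + 4), ENNReal.ofReal_mul hδ.le,
          ENNReal.ofReal_add (NNReal.coe_nonneg N) (by norm_num), ENNReal.ofReal_coe_nnreal,
          ENNReal.ofReal_ofNat]

/-- Double the index of a seminorm: the weight of `K n j` is `a_n 2 ^ (-j)`. -/
noncomputable def MixedIndex.double (i : MixedIndex E) (K : ℕ → ℕ → Set E)
    (hK : ∀ n j, IsCompact (K n j)) : MixedIndex E where
  C := fun m => K m.unpair.1 m.unpair.2
  isCompact_C := fun m => hK _ _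
  a := fun m => i.a m.unpair.1 * 2⁻¹ ^ m.unpair.2
  a_pos := fun m => mul_pos (i.a_pos _) (by positivity)
  tendsto_a := by
    obtain ⟨A, hA⟩ := i.tendsto_a.bddAbove_range
    have hA0 : 0 ≤ A := (i.a_pos 0).le.trans (hA ⟨0, rfl⟩)
    have h2 : Tendsto (fun j : ℕ => A * (2⁻¹ : ℝ) ^ j) atTop (𝓝 0) := by
      simpa using (tendsto_pow_atTop_nhds_zero_of_lt_one (by norm_num)
        (by norm_num : (2⁻¹ : ℝ) < 1)).const_mul A
    rw [Metric.tendsto_nhds]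
    intro ε hε
    obtain ⟨N, hN⟩ := eventually_atTop.1 (i.tendsto_a.eventually_lt_const hε)
    obtain ⟨J, hJ⟩ := eventually_atTop.1 (h2.eventually_lt_const hε)
    have hfin : {m : ℕ | m.unpair.1 < N ∧ m.unpair.2 < J}.Finite := by
      refine (((Set.finite_Iio N).prod (Set.finite_Iio J)).preimage
        (f := Nat.unpair) (Nat.pairEquiv.symm.injective.injOn)).subset ?_
      exact fun m hm => ⟨hm.1, hm.2⟩
    rw [← Nat.cofinite_eq_atTop]
    filter_upwards [hfin.compl_mem_cofinite] with m hm
    rw [Real.dist_eq, sub_zero, abs_of_pos (mul_pos (i.a_pos _) (by positivity))]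
    by_cases h1 : m.unpair.1 < N
    · have h3 : J ≤ m.unpair.2 := not_lt.1 fun h => hm ⟨h1, h⟩
      exact (mul_le_mul_of_nonneg_right (hA ⟨_, rfl⟩) (by positivity)).trans_lt (hJ _ h3)
    · exact (mul_le_of_le_one_right (i.a_pos _).le
        (pow_le_one₀ (by norm_num) (by norm_num))).trans_lt (hN _ (not_lt.1 h1))

theorem le_of_mixedSeminorm_double_lt {κ : C(E, ℝ)} {i : MixedIndex E} {K : ℕ → ℕ → Set E}
    {hK : ∀ n j, IsCompact (K n j)} {φ : WeightedCont κ} {δ : ℝ}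
    (h : mixedSeminorm κ (i.double K hK) φ < δ) (n j : ℕ) {y : E} (hy : y ∈ K n j) :
    |κ y * φ y| ≤ 2 ^ j * (δ / i.a n) := by
  have h1 := (le_mixedValue (i.double K hK) φ (Nat.pair n j) y
    (by simpa [MixedIndex.double] using hy)).trans h.le
  simp only [MixedIndex.double, Nat.unpair_pair] at h1
  have ha := i.a_pos n
  rw [← mul_div_assoc, le_div_iff₀ ha]
  rw [inv_pow, mul_right_comm, ← div_eq_mul_inv, div_le_iff₀ (by positivity)] at h1
  linarith

/-- Kernels that are bounded and tight on compact sets, uniformly for `t ≤ T`, act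
equicontinuously. -/
theorem locally_equicontinuous_of_kernels [T2Space E] [MeasurableSpace E] [BorelSpace E]
    {κ : C(E, ℝ)} (hκ : ∀ x, 0 < κ x) {P : ℝ≥0 → WeightedCont κ →ₗ[ℝ] WeightedCont κ}
    {μ : ℝ≥0 → E → WeightedMeasure κ} (hint : ∀ t φ x, P t φ x = (μ t x).integral φ)
    {T N : ℝ≥0} (hN : ∀ t ≤ T, ∀ x,
      (ENNReal.ofReal (κ x) • divWeight κ (μ t x).variation) Set.univ ≤ N)
    (htight : ∀ C : Set E, IsCompact C →
      IsTightMeasureSet {ρ : Measure E | ∃ x ∈ C, ∃ t ≤ T,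
        ρ = ENNReal.ofReal (κ x) • divWeight κ (μ t x).variation})
    {ε : ℝ} (hε : 0 < ε) (i : MixedIndex E) :
    ∃ j : MixedIndex E, ∃ δ : ℝ, 0 < δ ∧ ∀ t ≤ T, ∀ φ₁ φ₂ : WeightedCont κ,
      mixedSeminorm κ j (φ₁ - φ₂) < δ → mixedSeminorm κ i (P t φ₁ - P t φ₂) < ε := by
  have hex : ∀ n j : ℕ, ∃ K : Set E, IsCompact K ∧ ∀ x ∈ i.C n, ∀ t ≤ T,
      (ENNReal.ofReal (κ x) • divWeight κ (μ t x).variation) Kᶜ ≤ (4⁻¹ : ℝ≥0∞) ^ j := by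
    intro n j
    obtain ⟨K, hK, h⟩ := isTightMeasureSet_iff_exists_isCompact_measure_compl_le.1
      (htight _ (i.isCompact_C n)) ((4⁻¹ : ℝ≥0∞) ^ j)
      (ENNReal.pow_pos (ENNReal.inv_pos.2 ENNReal.ofNat_ne_top) _)
    exact ⟨K, hK, fun x hx t ht => h _ ⟨x, hx, t, ht, rfl⟩⟩
  choose K hK hKle using hex
  have hδ : 0 < ε / (2 * (N + 4)) := by positivity
  refine ⟨i.double K hK, ε / (2 * (N + 4)), hδ, fun t ht φ₁ φ₂ hφ => ?_⟩
  rw [← map_sub]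
  refine lt_of_le_of_lt (mixedValue_le i _ (M := ε / 2) (by positivity) fun n x hx => ?_)
    (half_lt_self hε)
  have ha := i.a_pos n
  have h1 := ((μ t x).ofReal_abs_mul_integral_le hκ (φ₁ - φ₂) x).trans
    (lintegral_le_of_compl_le _ (hN t ht x) (fun j => (hK n j).measurableSet)
      (fun j => hKle n j x hx t ht) (div_pos hδ ha)
      fun j y hy => le_of_mixedSeminorm_double_lt hφ n j hy)
  rw [← hint, ENNReal.ofReal_le_ofReal_iff (by positivity)] at h1
  calc i.a n * |κ x * P t (φ₁ - φ₂) x|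
      ≤ i.a n * ((N + 4) * (ε / (2 * (N + 4)) / i.a n)) := by gcongr
    _ = ε / 2 := by field_simp

/-- Joint sequential convergence at `t = 0` is uniform on compact metrizable sets. -/
theorem eventually_forall_mem_isCompact_le {κ : C(E, ℝ)} {K : Set E} (hK : IsCompact K)
    (hKm : TopologicalSpace.MetrizableSpace K) {S : ℝ≥0 → WeightedCont κ} {φ : WeightedCont κ}
    (h : ∀ x : E, ∀ u : ℕ → E, Tendsto u atTop (𝓝 x) →
      Tendsto (fun z : ℝ≥0 × ℕ => S z.1 (u z.2)) (𝓝 0 ×ˢ atTop) (𝓝 (φ x)))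
    {η : ℝ} (hη : 0 < η) : ∀ᶠ t in 𝓝 0, ∀ x ∈ K, |κ x * (S t - φ) x| ≤ η := by
  by_contra hcon
  obtain ⟨t, ht, hbad⟩ := exists_seq_forall_of_frequently (not_eventually.1 hcon)
  push Not at hbad
  choose x hxK hx using hbad
  have : CompactSpace K := isCompact_iff_compactSpace.1 hK
  obtain ⟨z, ψ, hψ, hlim⟩ := CompactSpace.tendsto_subseq fun k => (⟨x k, hxK k⟩ : K)
  have hu : Tendsto (fun k => x (ψ k)) atTop (𝓝 (z : E)) :=
    (continuous_subtype_val.tendsto z).comp hlim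
  have h1 : Tendsto (fun k => S (t (ψ k)) (x (ψ k))) atTop (𝓝 (φ z)) :=
    (h z _ hu).comp ((ht.comp hψ.tendsto_atTop).prodMk tendsto_id)
  have h2 : Tendsto (fun k => φ (x (ψ k))) atTop (𝓝 (φ z)) := (φ.continuous.tendsto _).comp hu
  have h3 : Tendsto (fun k => κ (x (ψ k))) atTop (𝓝 (κ z)) := (κ.continuous.tendsto _).comp hu
  have h4 : Tendsto (fun k => |κ (x (ψ k)) * (S (t (ψ k)) - φ) (x (ψ k))|) atTop (𝓝 0) := by
    simpa [WeightedCont.sub_apply] using (h3.mul (h1.sub h2)).abs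
  obtain ⟨k, hk⟩ := (h4.eventually_lt_const hη).exists
  exact absurd hk (hx (ψ k)).le.not_gt

/-- A bounded family that converges uniformly on compact sets converges in the mixed topology. -/
theorem tendsto_mixed_of_bounded {κ : C(E, ℝ)} {ι : Type*} {l : Filter ι}
    {S : ι → WeightedCont κ} {φ : WeightedCont κ} {M : ℝ}
    (hM : ∀ᶠ t in l, ∀ x, |κ x * (S t - φ) x| ≤ M)
    (hunif : ∀ K : Set E, IsCompact K → ∀ η : ℝ, 0 < η →
      ∀ᶠ t in l, ∀ x ∈ K, |κ x * (S t - φ) x| ≤ η) : Tendsto S l (𝓝 φ) := by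
  rw [(withSeminorms_mixedSeminorm κ).tendsto_nhds]
  intro i ε hε
  obtain ⟨A, hA⟩ := i.tendsto_a.bddAbove_range
  have hA0 : 0 < A := (i.a_pos 0).trans_le (hA ⟨0, rfl⟩)
  have hlim : Tendsto (fun n => i.a n * M) atTop (𝓝 0) := by simpa using i.tendsto_a.mul_const M
  obtain ⟨N, hN⟩ := eventually_atTop.1 (hlim.eventually_lt_const (half_pos hε))
  have hfin : ∀ᶠ t in l, ∀ n ∈ Finset.range N, ∀ x ∈ i.C n,
      |κ x * (S t - φ) x| ≤ ε / 2 / A :=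
    (Finset.range N).eventually_all.2 fun n _ => hunif _ (i.isCompact_C n) _ (by positivity)
  filter_upwards [hM, hfin] with t ht1 ht2
  refine lt_of_le_of_lt (mixedValue_le i _ (M := ε / 2) (by positivity) fun n x hx => ?_)
    (half_lt_self hε)
  by_cases hn : n < N
  · calc i.a n * |κ x * (S t - φ) x| ≤ A * (ε / 2 / A) :=
          mul_le_mul (hA ⟨n, rfl⟩) (ht2 n (Finset.mem_range.2 hn) x hx) (abs_nonneg _) hA0.le
      _ = ε / 2 := mul_div_cancel₀ _ hA0.ne'
  · exact (mul_le_mul_of_nonneg_left (ht1 x) (i.a_pos n).le).trans (hN n (not_lt.1 hn)).le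

theorem isC0Semigroup_of_kernels [T2Space E] [MeasurableSpace E] [BorelSpace E]
    (hE : ∀ K : Set E, IsCompact K → TopologicalSpace.MetrizableSpace K)
    {κ : C(E, ℝ)} (hκ : ∀ x, 0 < κ x) {P : ℝ≥0 → WeightedCont κ →ₗ[ℝ] WeightedCont κ}
    (hP : IsOperatorSemigroup κ (fun t φ => P t φ)) {μ : ℝ≥0 → E → WeightedMeasure κ}
    (hint : ∀ t φ x, P t φ x = (μ t x).integral φ)
    (hbdd : ∀ T : ℝ≥0, (⨆ t ≤ T, ⨆ x : E,
      ENNReal.ofReal (κ x) * ∫⁻ y, ENNReal.ofReal (κ y)⁻¹ ∂(μ t x).variation) < ∞)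
    (htight : ∀ T : ℝ≥0, ∀ C : Set E, IsCompact C →
      IsTightMeasureSet {ρ : Measure E | ∃ x ∈ C, ∃ t ≤ T,
        ρ = ENNReal.ofReal (κ x) • divWeight κ (μ t x).variation})
    (hlim : ∀ x : E, ∀ u : ℕ → E, Tendsto u atTop (𝓝 x) →
      Tendsto (fun p : ℝ≥0 × ℕ => μ p.1 (u p.2)) (𝓝 0 ×ˢ atTop)
        (𝓝 (WeightedMeasure.dirac κ x))) :
    IsC0Semigroup κ (fun t φ => P t φ) := by
  have hN : ∀ T : ℝ≥0, ∃ N : ℝ≥0, ∀ t ≤ T, ∀ x,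
      (ENNReal.ofReal (κ x) • divWeight κ (μ t x).variation) Set.univ ≤ N := by
    intro T
    obtain ⟨N, hN⟩ := ENNReal.lt_iff_exists_coe.1 (hbdd T)
    refine ⟨N, fun t ht x => ?_⟩
    rw [Measure.smul_apply, smul_eq_mul, divWeight_univ, ← hN.1]
    exact le_iSup₂_of_le t ht (le_iSup (fun x => ENNReal.ofReal (κ x) *
      ∫⁻ y, ENNReal.ofReal (κ y)⁻¹ ∂(μ t x).variation) x)
  refine ⟨hP, fun T ε hε i => ?_, fun φ => ?_⟩
  · obtain ⟨N, hN⟩ := hN T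
    exact locally_equicontinuous_of_kernels hκ hint hN (htight T) hε i
  · obtain ⟨N, hN⟩ := hN 1
    obtain ⟨M, hM⟩ := φ.exists_bound
    refine tendsto_mixed_of_bounded (M := |M| * N + |M|) ?_ fun K hK η hη =>
      eventually_forall_mem_isCompact_le hK (hE K hK) (fun x u hu => ?_) hη
    · filter_upwards [Iic_mem_nhds (zero_lt_one : (0 : ℝ≥0) < 1)] with t ht x
      have h1 : ENNReal.ofReal |κ x * P t φ x| ≤ ENNReal.ofReal (|M| * N) := by
        rw [hint]
        refine ((μ t x).ofReal_abs_mul_integral_le hκ φ x).trans ?_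
        calc _ ≤ ∫⁻ _, ENNReal.ofReal |M|
              ∂(ENNReal.ofReal (κ x) • divWeight κ (μ t x).variation) :=
              lintegral_mono fun y => ENNReal.ofReal_le_ofReal ((hM y).trans (le_abs_self M))
          _ ≤ ENNReal.ofReal |M| * N := by
              rw [lintegral_const]
              gcongr
              exact hN t ht x
          _ = _ := by rw [ENNReal.ofReal_mul (abs_nonneg M), ENNReal.ofReal_coe_nnreal]
      rw [ENNReal.ofReal_le_ofReal_iff (by positivity)] at h1
      rw [WeightedCont.sub_apply, mul_sub]
      exact (abs_sub _ _).trans (add_le_add h1 ((hM x).trans (le_abs_self M)))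
    · have h := WeightedMeasure.tendsto_nhds_iff.1 (hlim x u hu) φ
      simpa only [← hint, WeightedMeasure.integral_dirac] using h

end Backward

/-! ### Characterization of `C₀`-semigroups by kernels -/

theorem mainTheorem1 {E : Type*} [TopologicalSpace E] [CompletelyRegularSpace E] [T2Space E]
    [MeasurableSpace E] [BorelSpace E] (hE : IsStateSpace E)
    (κ : C(E, ℝ)) (hκ : ∀ x, 0 < κ x)
    (P : ℝ≥0 → WeightedCont κ →ₗ[ℝ] WeightedCont κ)
    (hP : IsOperatorSemigroup κ (fun t φ => P t φ)) :
    IsC0Semigroup κ (fun t φ => P t φ) ↔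
      ∃ μ : ℝ≥0 → E → WeightedMeasure κ,
        (∀ t, ∀ B : Set E, MeasurableSet B → Measurable fun x => (μ t x).value B) ∧
        (∀ t φ x, P t φ x = (μ t x).integral φ) ∧
        (∀ T : ℝ≥0, (⨆ t ≤ T, ⨆ x : E,
          ENNReal.ofReal (κ x) * ∫⁻ y, ENNReal.ofReal (κ y)⁻¹ ∂(μ t x).variation) < ∞) ∧
        (∀ T : ℝ≥0, ∀ C : Set E, IsCompact C →
          IsTightMeasureSet {ρ : Measure E | ∃ x ∈ C, ∃ t ≤ T,
            ρ = ENNReal.ofReal (κ x) • divWeight κ (μ t x).variation}) ∧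
        (∀ x : E, ∀ u : ℕ → E, Tendsto u atTop (𝓝 x) →
          Tendsto (fun p : ℝ≥0 × ℕ => μ p.1 (u p.2)) (𝓝 0 ×ˢ atTop)
            (𝓝 (WeightedMeasure.dirac κ x))) := by
  refine ⟨exists_kernels_of_isC0Semigroup hκ, ?_⟩
  rintro ⟨μ, -, hint, hbdd, htight, hlim⟩
  exact isC0Semigroup_of_kernels hE.metrizable_of_isCompact hκ hP hint hbdd htight hlim
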